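/- Push-Pull is the following process on a finite simple graph $G=(V,E)$. In round $0$ exactly one, arbitrarily given, node $s\in V$ is informed. In each round $t=1,2,\dots$ every node $v$ contacts a uniformly random neighbor, all choices being independent over nodes and rounds; every node that was informed before the round informs the node it contacts, and every node that was not informed before the round becomes informed if the node it contacts was. For $S\subseteq V$ let $\partial S$ be the set of nodes of $V\setminus S$ that have a neighbor in $S$. The vertex expansion of $G$ is $\alpha(G)=\min\{|\partial S|/|S| : S\subset V,\ 0<|S|\le |V|/2\}$ (with $\alpha(G)=\infty$ if $|V|=1$). **Theorem 1.** For every constant $\beta>0$ there are constants $C,K>0$, depending only on $\beta$, such that the following holds. Let $G=(V,E)$ be a graph with $|V|=n$ nodes, maximum degree at most $\Delta$, and vertex expansion at least $\alpha$, where $\alpha>0$ (so $G$ is connected). Then, for every initially informed node $s$, with probability at least $1-K n^{-\beta}$, Push-Pull informs all nodes of $G$ within at most $C\,\log n\cdot\log(\Delta)/\alpha$ rounds. -/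

import Mathlib

open MeasureTheory
open scoped ENNReal

namespace RumorSpreading

variable {V : Type*} [Fintype V] [DecidableEq V] (G : SimpleGraph V) [DecidableRel G.Adj]

/-- The boundary `∂S` of a set `S` of nodes: the nodes outside `S` that have a neighbor in `S`. -/
def boundary (S : Finset V) : Finset V :=
  {v | v ∉ S ∧ (G.neighborFinset v ∩ S).Nonempty}

/-- The vertex expansion of `G`: the minimum of `|∂S| / |S|` over all `S` with `0 < |S| ≤ n / 2`.
It is valued in `ℝ≥0∞`, so that it is `∞` for the one-node graph, which has no such `S`. -/
noncomputable def vertexExpansion : ℝ≥0∞ :=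
  ⨅ S : {S : Finset V // S.Nonempty ∧ 2 * S.card ≤ Fintype.card V},
    ((boundary G S.1).card : ℝ≥0∞) / (S.1.card : ℝ≥0∞)

/-- The law of the node contacted by `v` in one round: a uniformly random neighbor of `v`.
A node without neighbors contacts nobody, which is encoded as a call to itself. -/
noncomputable def contactPMF (v : V) : PMF V :=
  if h : (G.neighborFinset v).Nonempty then PMF.uniformOfFinset (G.neighborFinset v) h
  else PMF.pure v

/-- The set of nodes informed after one round of Push-Pull, if `S` is the set of nodes informed
before the round and each node `v` contacts `c v` in the round: informed nodes push the rumor to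
the node they contact, uninformed nodes pull it from the node they contact. -/
def pushPullRound (S : Finset V) (c : V → V) : Finset V :=
  S ∪ ({v | ∃ u ∈ S, c u = v} : Finset V) ∪ ({v | c v ∈ S} : Finset V)

/-- The set `I_t` of nodes informed after the first `t` rounds of Push-Pull with initially informed
node `s`, where `ω i v` is the node that `v` contacts in round `i + 1`. -/
def informed (s : V) (ω : ℕ → V → V) : ℕ → Finset V
  | 0 => {s}
  | t + 1 => pushPullRound (informed s ω t) (ω t)

/-- The law of all contacts: all nodes choose independently, and afresh in every round. -/
noncomputable def contactMeasure [MeasurableSpace V] : Measure (ℕ → V → V) :=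
  Measure.infinitePi fun _ : ℕ => Measure.pi fun v : V => (contactPMF G v).toMeasure

end RumorSpreading

/-!
Push-Pull informs every node of a graph of vertex expansion `α` and maximum degree `Δ` within
`O(log n · log Δ / α)` rounds, with high probability.

Let `S` be the set of informed nodes, `B = ∂S` its boundary and `m = |S ∪ B|`. The proof follows the
potential `1 / (|S| m)`, which lies between `1 / n ^ 2` and `1`. If `2 |S| ≤ n`, then within
`2 J + 1 = O(log Δ)` rounds its expectation drops by a factor `1 - Ω(|B| / m)`, hence by a factor
`1 - Ω(α)` (`callsExp_spreadPotential_le`). So after `O(log n / α)` such phases Markov's inequality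
shows that more than half of the nodes are informed (`callsExp_half_le`). A call transmits the rumor
in both directions, so the process looks the same in reversed time: a second period of the same
length, run backwards from a node `v`, also reaches more than half of the nodes, and the two
majorities meet (`callsExp_spread_eq_univ_ge`). A union bound over `v` concludes.

The drop of the potential has three sources.

* If half of `B` has degree at least `2 m`, then pushes inform one of these nodes with probability
  `Ω(|B| / m)`, which doubles `|S ∪ ∂S|` (`roundExp_closedNbhd_le_of_large_degree`).
* Otherwise let `M` be the part of `B` of degree less than `2 m`. Each `v ∈ M` is informed by a
  pull with probability at least `1 / d(v)`. With `q(w) = ∑ 1 / d(v)` over the neighbors `v ∈ M` of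
  `w`, a node `w ∉ S ∪ B` joins `S ∪ ∂S` with probability at least `min 1 (q(w)) / 2`; if these add
  up to `Ω(|B|)`, then `|S ∪ ∂S|` grows (`roundExp_closedNbhd_le_of_small_degree`).
* Otherwise, the calls of `M` rarely go to nodes `w ∉ S ∪ B` with `q(w) < 1 / 8`, and `M` contains
  a set `A` of `Ω(|B|)` nodes such that every `v ∈ A` has most of its neighbors in `S`, in `A`, or
  among the nodes contacted by `A` at rate at least `1 / 8` (`exists_self_supporting_subset`). In
  reversed time, the rumor from `v ∈ A` grows within `A` by a constant factor every two rounds,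
  until it hits `S` or has reached a set `R ⊆ A` with `∑ 1 / d(u) ≥ 1 / 16` over `u ∈ R`, which
  pulls from `S` with constant probability (`roundExp_stragglerPotential_le`). As long as that sum
  is smaller, `|R| ≤ Δ / 16`, so `O(log Δ)` rounds suffice, each `v ∈ A` is informed with constant
  probability, and `|S|` grows by `Ω(|B|)` in expectation (`callsExp_mem_spread_ge`).

Growth is measured by expectations of inverse sizes, so that no concentration is needed. Only
finitely many rounds matter, so all expectations are finite sums, over the contacts of one round
(`roundExp`) or of a list of rounds (`callsExp`).
-/

set_option linter.unusedSectionVars false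

namespace RumorSpreading

variable {V : Type*} [Fintype V] [DecidableEq V] (G : SimpleGraph V) [DecidableRel G.Adj]

/-! ### Expectations over one round -/

/-- The probability that `v` contacts `a` in a given round. -/
noncomputable def callProb (v a : V) : ℝ := (contactPMF G v a).toReal

lemma callProb_nonneg (v a : V) : 0 ≤ callProb G v a := ENNReal.toReal_nonneg

lemma sum_callProb (v : V) : ∑ a, callProb G v a = 1 := by
  unfold callProb
  rw [← ENNReal.toReal_sum fun a _ => PMF.apply_ne_top _ a, ← tsum_fintype (L := .unconditional V),
    PMF.tsum_coe, ENNReal.toReal_one]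

lemma callProb_of_adj {v a : V} (h : G.Adj v a) : callProb G v a = 1 / G.degree v := by
  have hne : (G.neighborFinset v).Nonempty := ⟨a, by simpa using h⟩
  simp [callProb, contactPMF, hne, h]

/-- The probability that the contacts in a given round are exactly `c`. -/
noncomputable def roundWeight (c : V → V) : ℝ := ∏ v, callProb G v (c v)

lemma roundWeight_nonneg (c : V → V) : 0 ≤ roundWeight G c :=
  Finset.prod_nonneg fun _ _ => callProb_nonneg G _ _

/-- The expectation of a function of the contacts of one round. -/
noncomputable def roundExp (F : (V → V) → ℝ) : ℝ := ∑ c, roundWeight G c * F c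

lemma roundExp_prod (f : V → V → ℝ) :
    roundExp G (fun c => ∏ v, f v (c v)) = ∏ v, ∑ a, callProb G v a * f v a := by
  simp only [roundExp, roundWeight, ← Finset.prod_mul_distrib]
  rw [Finset.prod_univ_sum, Fintype.piFinset_univ]

lemma roundExp_one : roundExp G (fun _ => 1) = 1 := by
  have := roundExp_prod G (fun _ _ => 1)
  simpa [sum_callProb] using this

lemma roundExp_mono {F F' : (V → V) → ℝ} (h : ∀ c, F c ≤ F' c) : roundExp G F ≤ roundExp G F' :=
  Finset.sum_le_sum fun c _ => mul_le_mul_of_nonneg_left (h c) (roundWeight_nonneg G c)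

lemma roundExp_const_mul (a : ℝ) (F : (V → V) → ℝ) :
    roundExp G (fun c => a * F c) = a * roundExp G F := by
  simp only [roundExp, Finset.mul_sum]
  exact Finset.sum_congr rfl fun c _ => by ring

lemma roundExp_const (a : ℝ) : roundExp G (fun _ => a) = a := by
  simpa [roundExp_one] using roundExp_const_mul G a (fun _ => 1)

lemma roundExp_sub (F F' : (V → V) → ℝ) :
    roundExp G (fun c => F c - F' c) = roundExp G F - roundExp G F' := by
  simp only [roundExp, mul_sub, Finset.sum_sub_distrib]

lemma roundExp_sum {ι : Type*} (s : Finset ι) (F : ι → (V → V) → ℝ) :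
    roundExp G (fun c => ∑ i ∈ s, F i c) = ∑ i ∈ s, roundExp G (F i) := by
  simp only [roundExp, Finset.mul_sum]
  exact Finset.sum_comm

lemma roundExp_nonneg {F : (V → V) → ℝ} (h : ∀ c, 0 ≤ F c) : 0 ≤ roundExp G F :=
  Finset.sum_nonneg fun c _ => mul_nonneg (roundWeight_nonneg G c) (h c)

lemma roundExp_sub_mul (a b : ℝ) (F : (V → V) → ℝ) :
    roundExp G (fun c => a - b * F c) = a - b * roundExp G F := by
  rw [roundExp_sub, roundExp_const, roundExp_const_mul]

/-- The calls of `v` are independent of those of the other nodes. -/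
lemma roundExp_mul_prod_of_eq_one (v : V) (f : V → ℝ) (g : V → V → ℝ) (hg : ∀ a, g v a = 1) :
    roundExp G (fun c => f (c v) * ∏ u, g u (c u)) =
      (∑ a, callProb G v a * f a) * roundExp G (fun c => ∏ u, g u (c u)) := by
  have h1 : ∀ c : V → V, f (c v) * ∏ u, g u (c u) =
      ∏ u, (if u = v then f (c u) else 1) * g u (c u) := by
    intro c
    rw [Finset.prod_mul_distrib]
    simp
  simp only [h1]
  rw [roundExp_prod G (fun u a => (if u = v then f a else 1) * g u a), roundExp_prod]
  have h2 : ∑ a, callProb G v a * f a =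
      ∏ u, if u = v then ∑ a, callProb G u a * f a else 1 := by simp
  rw [h2, ← Finset.prod_mul_distrib]
  refine Finset.prod_congr rfl fun u _ => ?_
  split_ifs with h
  · subst h
    simp [hg, sum_callProb]
  · simp

lemma hit_eq_one_sub_prod (U : Finset V) (T : V → Finset V) (c : V → V) :
    (if ∃ u ∈ U, c u ∈ T u then (1 : ℝ) else 0) =
      1 - 1 * ∏ v, (if v ∈ U ∧ c v ∈ T v then (0 : ℝ) else 1) := by
  split_ifs with h
  · obtain ⟨u, hu, hc⟩ := h
    rw [Finset.prod_eq_zero (Finset.mem_univ u) (by simp [hu, hc])]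
    simp
  · rw [Finset.prod_eq_one]
    · simp
    · intro v _
      rw [if_neg]
      exact fun hv => h ⟨v, hv⟩

lemma roundExp_call (v a : V) :
    roundExp G (fun c => if c v = a then 1 else 0) = callProb G v a := by
  have := roundExp_mul_prod_of_eq_one G v (fun b => if b = a then 1 else 0) (fun _ _ => 1)
    (fun _ => rfl)
  simpa [roundExp_one] using this

lemma roundExp_call_mul_hit {v : V} (a : V) {U : Finset V} (hv : v ∉ U) (T : V → Finset V) :
    roundExp G (fun c => (if c v = a then 1 else 0) * (if ∃ u ∈ U, c u ∈ T u then 1 else 0)) =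
      callProb G v a * roundExp G (fun c => if ∃ u ∈ U, c u ∈ T u then 1 else 0) := by
  simp only [hit_eq_one_sub_prod, mul_sub, one_mul, mul_one]
  rw [roundExp_sub, roundExp_sub, roundExp_call, roundExp_one,
    roundExp_mul_prod_of_eq_one G v (fun b => if b = a then 1 else 0)
      (fun u b => if u ∈ U ∧ b ∈ T u then (0 : ℝ) else 1) (by simp [hv])]
  simp only [mul_ite, mul_one, mul_zero, Finset.sum_ite_eq', Finset.mem_univ, if_true, mul_sub]

/-- If every `u ∈ U` has its own set `T u` of targets, then by independence the probability that
nobody in `U` contacts a target is at most `exp (-μ)`, where `μ` is the expected number of nodes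
of `U` that do. -/
lemma one_sub_exp_le_roundExp_hit (U : Finset V) (T : V → Finset V) :
    1 - Real.exp (-∑ u ∈ U, ∑ a ∈ T u, callProb G u a) ≤
      roundExp G (fun c => if ∃ u ∈ U, c u ∈ T u then 1 else 0) := by
  simp only [hit_eq_one_sub_prod]
  rw [roundExp_sub_mul, roundExp_prod G (fun v a => if v ∈ U ∧ a ∈ T v then (0 : ℝ) else 1),
    one_mul]
  refine sub_le_sub_left ?_ _
  have hfac : ∀ v, ∑ a, callProb G v a * (if v ∈ U ∧ a ∈ T v then (0 : ℝ) else 1) =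
      1 - if v ∈ U then ∑ a ∈ T v, callProb G v a else 0 := by
    intro v
    rw [eq_sub_iff_add_eq]
    refine Eq.trans ?_ (sum_callProb G v)
    by_cases hv : v ∈ U
    · have hT : ∑ a ∈ T v, callProb G v a = ∑ a, if a ∈ T v then callProb G v a else 0 := by
        simp [Finset.sum_ite_mem]
      simp only [hv, true_and, if_true, hT]
      rw [← Finset.sum_add_distrib]
      refine Finset.sum_congr rfl fun a _ => ?_
      split_ifs <;> simp
    · simp [hv]
  have hsum : -∑ u ∈ U, ∑ a ∈ T u, callProb G u a =
      ∑ v, -(if v ∈ U then ∑ a ∈ T v, callProb G v a else 0) := by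
    simp [Finset.sum_ite_mem]
  rw [hsum, Real.exp_sum]
  refine Finset.prod_le_prod (fun v _ => ?_) fun v _ => ?_
  · refine Finset.sum_nonneg fun a _ => mul_nonneg (callProb_nonneg G _ _) ?_
    split_ifs <;> norm_num
  · rw [hfac]
    exact Real.one_sub_le_exp_neg _

lemma half_le_one_sub_exp_neg {x : ℝ} (h0 : 0 ≤ x) (h1 : x ≤ 1) : x / 2 ≤ 1 - Real.exp (-x) := by
  have h : Real.exp (-x) ≤ 1 / (1 + x) := by
    rw [Real.exp_neg, inv_eq_one_div]
    exact one_div_le_one_div_of_le (by linarith) (by linarith [Real.add_one_le_exp x])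
  have h2 : 1 / (1 + x) ≤ 1 - x / 2 := by
    rw [div_le_iff₀ (by linarith)]
    nlinarith
  linarith

lemma half_le_roundExp_hit (U : Finset V) (T : V → Finset V) {x : ℝ} (h0 : 0 ≤ x) (h1 : x ≤ 1)
    (hx : x ≤ ∑ u ∈ U, ∑ a ∈ T u, callProb G u a) :
    x / 2 ≤ roundExp G (fun c => if ∃ u ∈ U, c u ∈ T u then 1 else 0) := by
  refine le_trans (half_le_one_sub_exp_neg h0 h1) (le_trans ?_ (one_sub_exp_le_roundExp_hit G U T))
  exact sub_le_sub_left (Real.exp_le_exp.2 (neg_le_neg hx)) _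

lemma sum_callProb_eq_card_div_degree (v : V) {T : Finset V} (hT : T ⊆ G.neighborFinset v) :
    ∑ a ∈ T, callProb G v a = (T.card : ℝ) / G.degree v := by
  rw [Finset.sum_congr rfl fun a ha => callProb_of_adj G
    ((SimpleGraph.mem_neighborFinset _ _ _).1 (hT ha))]
  simp [div_eq_mul_inv]

/-! ### Expectations over several rounds -/

/-- The expectation of a function of the contacts of `t` independent rounds, listed in order. -/
noncomputable def callsExp : ℕ → (List (V → V) → ℝ) → ℝ
  | 0, F => F []
  | t + 1, F => roundExp G fun c => callsExp t fun l => F (c :: l)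

lemma callsExp_mono {t : ℕ} {F F' : List (V → V) → ℝ} (h : ∀ l, F l ≤ F' l) :
    callsExp G t F ≤ callsExp G t F' := by
  induction t generalizing F F' with
  | zero => exact h []
  | succ t ih => exact roundExp_mono G fun c => ih fun l => h _

lemma callsExp_const_mul (t : ℕ) (a : ℝ) (F : List (V → V) → ℝ) :
    callsExp G t (fun l => a * F l) = a * callsExp G t F := by
  induction t generalizing F with
  | zero => rfl
  | succ t ih => simp only [callsExp, ih, roundExp_const_mul]

lemma callsExp_const (t : ℕ) (a : ℝ) : callsExp G t (fun _ => a) = a := by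
  induction t with
  | zero => rfl
  | succ t ih => simp only [callsExp, ih, roundExp_const]

lemma callsExp_sub (t : ℕ) (F F' : List (V → V) → ℝ) :
    callsExp G t (fun l => F l - F' l) = callsExp G t F - callsExp G t F' := by
  induction t generalizing F F' with
  | zero => rfl
  | succ t ih => simp only [callsExp, ih, roundExp_sub]

lemma callsExp_sum {ι : Type*} (t : ℕ) (s : Finset ι) (F : ι → List (V → V) → ℝ) :
    callsExp G t (fun l => ∑ i ∈ s, F i l) = ∑ i ∈ s, callsExp G t (F i) := by
  induction t generalizing F with
  | zero => rfl
  | succ t ih => simp only [callsExp, ih, roundExp_sum]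

lemma callsExp_add_rounds (s t : ℕ) (F : List (V → V) → ℝ) :
    callsExp G (s + t) F = callsExp G s fun l => callsExp G t fun l' => F (l ++ l') := by
  induction s generalizing F with
  | zero => simp [callsExp]
  | succ s ih => simp only [Nat.succ_add, callsExp, ih, List.cons_append]

lemma callsExp_roundExp_comm (t : ℕ) (F : List (V → V) → (V → V) → ℝ) :
    callsExp G t (fun l => roundExp G (F l)) = roundExp G fun c => callsExp G t fun l => F l c := by
  simp only [roundExp, callsExp_sum, callsExp_const_mul]

lemma callsExp_succ_append (t : ℕ) (F : List (V → V) → ℝ) :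
    callsExp G (t + 1) F = callsExp G t fun l => roundExp G fun c => F (l ++ [c]) := by
  rw [callsExp_add_rounds]
  rfl

/-- The rounds are independent and identically distributed, so their order can be reversed. -/
lemma callsExp_reverse (t : ℕ) (F : List (V → V) → ℝ) :
    callsExp G t (fun l => F l.reverse) = callsExp G t F := by
  induction t generalizing F with
  | zero => rfl
  | succ t ih =>
    rw [callsExp_succ_append, callsExp_roundExp_comm]
    simp only [List.reverse_append, List.reverse_cons, List.reverse_nil, List.nil_append,
      List.singleton_append, callsExp]
    congr 1
    funext c
    exact ih fun l => F (c :: l)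

/-! ### The spread of the rumor along a list of rounds -/

/-- The set of informed nodes after the rounds with contacts `l`, if `S` was informed before. -/
def spread (S : Finset V) (l : List (V → V)) : Finset V := l.foldl pushPullRound S

lemma mem_pushPullRound {S : Finset V} {c : V → V} {v : V} :
    v ∈ pushPullRound S c ↔ v ∈ S ∨ (∃ u ∈ S, c u = v) ∨ c v ∈ S := by
  simp [pushPullRound]

lemma subset_pushPullRound (S : Finset V) (c : V → V) : S ⊆ pushPullRound S c :=
  fun _ hv => mem_pushPullRound.2 (Or.inl hv)

lemma spread_cons (S : Finset V) (c : V → V) (l : List (V → V)) :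
    spread S (c :: l) = spread (pushPullRound S c) l := rfl

lemma spread_append (S : Finset V) (l l' : List (V → V)) :
    spread S (l ++ l') = spread (spread S l) l' := List.foldl_append

lemma subset_spread (S : Finset V) (l : List (V → V)) : S ⊆ spread S l := by
  induction l generalizing S with
  | nil => exact subset_rfl
  | cons c l ih => exact (subset_pushPullRound S c).trans (ih _)

/-- Calls transmit in both directions, so a round takes `S` into contact with `T` if and only if
it takes `T` into contact with `S`. -/
lemma pushPullRound_meets_iff (S T : Finset V) (c : V → V) :
    (∃ v ∈ pushPullRound S c, v ∈ T) ↔ ∃ v ∈ S, v ∈ pushPullRound T c := by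
  simp only [mem_pushPullRound]
  constructor
  · rintro ⟨v, hS | ⟨u, hu, rfl⟩ | hv, hT⟩
    · exact ⟨v, hS, Or.inl hT⟩
    · exact ⟨u, hu, Or.inr (Or.inr hT)⟩
    · exact ⟨c v, hv, Or.inr (Or.inl ⟨v, hT, rfl⟩)⟩
  · rintro ⟨v, hS, hT | ⟨u, hu, rfl⟩ | hv⟩
    · exact ⟨v, Or.inl hS, hT⟩
    · exact ⟨u, Or.inr (Or.inr hS), hu⟩
    · exact ⟨c v, Or.inr (Or.inl ⟨v, hS, rfl⟩), hv⟩

/-- Time reversal: the rumor goes from `S` to `T` along `l` if and only if it goes from `T` to `S`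
along the reverse of `l`. -/
lemma spread_meets_iff (S T : Finset V) (l : List (V → V)) :
    (∃ v ∈ spread S l, v ∈ T) ↔ ∃ v ∈ S, v ∈ spread T l.reverse := by
  induction l generalizing S with
  | nil => exact Iff.rfl
  | cons c l ih =>
    rw [spread_cons, ih, pushPullRound_meets_iff, List.reverse_cons, spread_append]
    rfl

/-! ### Growth of the closed neighborhood in one round -/

/-- The closed neighborhood `S ∪ ∂S`. -/
def closedNbhd (S : Finset V) : Finset V := S ∪ boundary G S

lemma mem_boundary {S : Finset V} {v : V} : v ∈ boundary G S ↔ v ∉ S ∧ ∃ u ∈ S, G.Adj u v := by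
  simp only [boundary, Finset.mem_filter, Finset.mem_univ, true_and, Finset.Nonempty,
    Finset.mem_inter, SimpleGraph.mem_neighborFinset]
  exact and_congr_right fun _ => exists_congr fun u => by rw [and_comm, G.adj_comm]

lemma mem_closedNbhd {S : Finset V} {w : V} :
    w ∈ closedNbhd G S ↔ w ∈ S ∨ ∃ u ∈ S, G.Adj u w := by
  rw [closedNbhd, Finset.mem_union, mem_boundary]
  tauto

lemma closedNbhd_mono {S T : Finset V} (h : S ⊆ T) : closedNbhd G S ⊆ closedNbhd G T := by
  intro w
  simp only [mem_closedNbhd]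
  rintro (hw | ⟨u, hu, huw⟩)
  · exact Or.inl (h hw)
  · exact Or.inr ⟨u, h hu, huw⟩

lemma card_closedNbhd (S : Finset V) :
    (closedNbhd G S).card = S.card + (boundary G S).card := by
  refine Finset.card_union_of_disjoint (Finset.disjoint_left.2 fun v hv hb => ?_)
  exact ((mem_boundary G).1 hb).1 hv

lemma neighborFinset_subset_closedNbhd {S : Finset V} {u : V} (hu : u ∈ S) :
    G.neighborFinset u ⊆ closedNbhd G S := by
  intro w hw
  exact (mem_closedNbhd G).2 (Or.inr ⟨u, hu, by simpa using hw⟩)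

lemma degree_le_card_closedNbhd {S : Finset V} {u : V} (hu : u ∈ S) :
    G.degree u ≤ (closedNbhd G S).card :=
  Finset.card_le_card (neighborFinset_subset_closedNbhd G hu)

/-- The total inverse degree of the neighbors of `w` in `A`: the expected number of nodes of `A`
that contact `w` in one round. -/
noncomputable def nbrWeight (A : Finset V) (w : V) : ℝ :=
  ∑ v ∈ A with G.Adj v w, 1 / (G.degree v : ℝ)

lemma nbrWeight_nonneg (A : Finset V) (w : V) : 0 ≤ nbrWeight G A w :=
  Finset.sum_nonneg fun _ _ => by positivity

/-- The boundary nodes of very large degree are reached by pushes, from nodes whose degrees are at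
most `|S ∪ ∂S|`; a single one of them doubles the closed neighborhood. -/
lemma roundExp_closedNbhd_le_of_large_degree {S H : Finset V} (hS : S.Nonempty)
    (hH : H ⊆ boundary G S) (hdeg : ∀ v ∈ H, 2 * (closedNbhd G S).card ≤ G.degree v) :
    roundExp G (fun c => ((closedNbhd G S).card : ℝ) / (closedNbhd G (pushPullRound S c)).card) ≤
      1 - (H.card : ℝ) / (4 * (closedNbhd G S).card) := by
  set m := (closedNbhd G S).card with hm
  have hm0 : 0 < m := by
    have := hS.card_pos
    have := card_closedNbhd G S
    omega
  have hm0' : (0 : ℝ) < m := by exact_mod_cast hm0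
  have hHm : H.card ≤ m :=
    (Finset.card_le_card hH).trans (by have := card_closedNbhd G S; omega)
  have hpt : ∀ c : V → V, (m : ℝ) / (closedNbhd G (pushPullRound S c)).card ≤
      1 - 1 / 2 * (if ∃ u ∈ S, c u ∈ G.neighborFinset u ∩ H then 1 else 0) := by
    intro c
    have hmono : m ≤ (closedNbhd G (pushPullRound S c)).card :=
      Finset.card_le_card (closedNbhd_mono G (subset_pushPullRound S c))
    have hpos : (0 : ℝ) < (closedNbhd G (pushPullRound S c)).card := by
      exact_mod_cast hm0.trans_le hmono
    rw [div_le_iff₀ hpos]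
    split_ifs with h
    · obtain ⟨u, hu, hc⟩ := h
      have hcu : c u ∈ pushPullRound S c := mem_pushPullRound.2 (Or.inr (Or.inl ⟨u, hu, rfl⟩))
      have h1 : ((2 * m : ℕ) : ℝ) ≤ (closedNbhd G (pushPullRound S c)).card := by
        exact_mod_cast (hdeg _ (Finset.mem_inter.1 hc).2).trans (degree_le_card_closedNbhd G hcu)
      push_cast at h1
      linarith
    · have h1 : (m : ℝ) ≤ (closedNbhd G (pushPullRound S c)).card := by exact_mod_cast hmono
      linarith
  refine (roundExp_mono G hpt).trans ?_
  rw [roundExp_sub_mul]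
  have hhit := half_le_roundExp_hit G S (fun u => G.neighborFinset u ∩ H)
    (x := (H.card : ℝ) / m) (by positivity)
    (by rw [div_le_one hm0']; exact_mod_cast hHm) ?_
  · have : (H.card : ℝ) / (4 * m) = 1 / 2 * ((H.card : ℝ) / m / 2) := by field_simp; norm_num
    linarith
  · have hcov : H ⊆ S.biUnion fun u => G.neighborFinset u ∩ H := by
      intro v hv
      obtain ⟨-, u, hu, huv⟩ := (mem_boundary G).1 (hH hv)
      exact Finset.mem_biUnion.2 ⟨u, hu, by simp [hv, huv]⟩
    have hcard : (H.card : ℝ) ≤ ∑ u ∈ S, ((G.neighborFinset u ∩ H).card : ℝ) := by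
      exact_mod_cast (Finset.card_le_card hcov).trans Finset.card_biUnion_le
    refine (div_le_div_of_nonneg_right hcard hm0'.le).trans ?_
    rw [Finset.sum_div]
    refine Finset.sum_le_sum fun u hu => ?_
    rw [sum_callProb_eq_card_div_degree G u Finset.inter_subset_left]
    rcases Nat.eq_zero_or_pos (G.degree u) with h0 | h0
    · have : (G.neighborFinset u ∩ H).card = 0 :=
        Nat.le_zero.1 ((Finset.card_le_card Finset.inter_subset_left).trans h0.le)
      simp [this]
    · refine div_le_div_of_nonneg_left (by positivity) (by exact_mod_cast h0) ?_
      exact_mod_cast degree_le_card_closedNbhd G hu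

/-- The boundary nodes `v ∈ A` of moderate degree are informed by a pull with probability at least
`1 / d(v)`, and then bring in all their neighbors. A new node may bring in as many as `2 |S ∪ ∂S|`
others, so that the number `Y` of nodes brought in need not be concentrated; but this is few enough
for `Y`, conditioned on its counting a given node, to have expectation `O(|S ∪ ∂S|)`. -/
lemma roundExp_closedNbhd_le_of_small_degree {S A : Finset V} (hS : S.Nonempty)
    (hA : A ⊆ boundary G S) (hdeg : ∀ v ∈ A, G.degree v ≤ 2 * (closedNbhd G S).card) :
    roundExp G (fun c => ((closedNbhd G S).card : ℝ) / (closedNbhd G (pushPullRound S c)).card) ≤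
      1 - (∑ w ∈ (closedNbhd G S)ᶜ, min 1 (nbrWeight G A w)) / (12 * (closedNbhd G S).card) := by
  set m := (closedNbhd G S).card with hm
  set L := (closedNbhd G S)ᶜ with hL
  have hm0 : 0 < m := by
    have := hS.card_pos
    have := card_closedNbhd G S
    omega
  have hm0' : (0 : ℝ) < m := by exact_mod_cast hm0
  have hAm : (A.card : ℝ) ≤ m := by
    exact_mod_cast (Finset.card_le_card hA).trans (by have := card_closedNbhd G S; omega)
  -- One informed neighbor is fixed for each boundary node: only pulls from it are counted.
  have hex : ∀ v, ∃ a, v ∈ A → a ∈ S ∧ G.Adj v a := by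
    intro v
    by_cases hv : v ∈ A
    · obtain ⟨-, u, hu, huv⟩ := (mem_boundary G).1 (hA hv)
      exact ⟨u, fun _ => ⟨hu, huv.symm⟩⟩
    · exact ⟨v, fun h => absurd h hv⟩
  choose s hs using hex
  have hdpos : ∀ v ∈ A, (0 : ℝ) < G.degree v := by
    intro v hv
    have : 0 < G.degree v := (G.degree_pos_iff_exists_adj v).2 ⟨_, (hs v hv).2⟩
    exact_mod_cast this
  set X : V → (V → V) → ℝ := fun v c => if c v = s v then 1 else 0 with hX
  set F : V → Finset V := fun w => A.filter fun v => G.Adj v w with hF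
  set cov : V → (V → V) → ℝ := fun w c => if ∃ v ∈ F w, c v ∈ ({s v} : Finset V) then 1 else 0
    with hcov
  have hX0 : ∀ v c, 0 ≤ X v c := fun v c => by simp only [hX]; split_ifs <;> norm_num
  have hcov0 : ∀ w c, 0 ≤ cov w c := fun w c => by simp only [hcov]; split_ifs <;> norm_num
  have hcov1 : ∀ w c, cov w c ≤ 1 := fun w c => by simp only [hcov]; split_ifs <;> norm_num
  have hcovX : ∀ w c, cov w c ≤ ∑ v ∈ F w, X v c := by
    intro w c
    simp only [hcov]
    split_ifs with h
    · obtain ⟨v, hv, hc⟩ := h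
      have : X v c = 1 := by simp only [hX]; rw [if_pos (by simpa using hc)]
      rw [← this]
      exact Finset.single_le_sum (f := fun v => X v c) (fun v _ => hX0 v c) hv
    · exact Finset.sum_nonneg fun v _ => hX0 v c
  have hYZ : ∀ c, ∑ w ∈ L, cov w c ≤ ∑ v ∈ A, (G.degree v : ℝ) * X v c := by
    intro c
    calc ∑ w ∈ L, cov w c ≤ ∑ w, ∑ v ∈ A, (if G.Adj v w then X v c else 0) := by
          refine (Finset.sum_le_sum fun w _ => hcovX w c).trans ?_
          simp only [hF, Finset.sum_filter]
          refine Finset.sum_le_sum_of_subset_of_nonneg (Finset.subset_univ _) fun w _ _ => ?_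
          refine Finset.sum_nonneg fun v _ => ?_
          split_ifs
          exacts [hX0 v c, le_rfl]
      _ = ∑ v ∈ A, (G.degree v : ℝ) * X v c := by
          rw [Finset.sum_comm]
          refine Finset.sum_congr rfl fun v _ => ?_
          rw [← Finset.sum_filter, Finset.sum_const, nsmul_eq_mul,
            ← SimpleGraph.card_neighborFinset_eq_degree, SimpleGraph.neighborFinset_eq_filter]
  have hnew : ∀ c, m + ∑ w ∈ L, cov w c ≤ (closedNbhd G (pushPullRound S c)).card := by
    intro c
    have h1 : ∑ w ∈ L, cov w c =
        ((L.filter fun w => ∃ v ∈ F w, c v ∈ ({s v} : Finset V)).card : ℝ) := by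
      simp only [hcov]
      rw [Finset.sum_boole]
    rw [h1, hm]
    norm_cast
    rw [← Finset.card_union_of_disjoint]
    · refine Finset.card_le_card (Finset.union_subset
        (closedNbhd_mono G (subset_pushPullRound S c)) fun w hw => ?_)
      obtain ⟨-, v, hv, hc⟩ := Finset.mem_filter.1 hw
      obtain ⟨hvA, hvw⟩ := Finset.mem_filter.1 hv
      refine (mem_closedNbhd G).2 (Or.inr ⟨v, mem_pushPullRound.2 (Or.inr (Or.inr ?_)), hvw⟩)
      rw [Finset.mem_singleton.1 hc]
      exact (hs v hvA).1
    · refine Finset.disjoint_left.2 fun w hw hw' => ?_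
      exact Finset.mem_compl.1 (Finset.mem_filter.1 hw').1 hw
  -- The tangent of `x ↦ 1 / x` at `6 m` replaces `1 / (m + Z)`.
  have hpt : ∀ c : V → V, (m : ℝ) / (closedNbhd G (pushPullRound S c)).card ≤
      1 - 1 / (36 * (m : ℝ) ^ 2) *
        ∑ w ∈ L, (11 * m * cov w c - ∑ v ∈ A, (G.degree v : ℝ) * (X v c * cov w c)) := by
    intro c
    set Y := ∑ w ∈ L, cov w c with hY
    set Z := ∑ v ∈ A, (G.degree v : ℝ) * X v c with hZ
    have hY0 : 0 ≤ Y := Finset.sum_nonneg fun w _ => hcov0 w c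
    have hrw : ∑ w ∈ L, (11 * m * cov w c - ∑ v ∈ A, (G.degree v : ℝ) * (X v c * cov w c)) =
        11 * m * Y - Z * Y := by
      rw [Finset.sum_sub_distrib, ← Finset.mul_sum, ← hY]
      congr 1
      rw [hZ, hY, Finset.sum_mul_sum, Finset.sum_comm]
      simp only [mul_assoc]
    rw [hrw]
    have hYZc : Y ≤ Z := hYZ c
    calc (m : ℝ) / (closedNbhd G (pushPullRound S c)).card ≤ m / (m + Y) :=
          div_le_div_of_nonneg_left hm0'.le (by positivity) (hnew c)
      _ ≤ 1 - 1 / (36 * (m : ℝ) ^ 2) * (11 * m * Y - Z * Y) := by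
          rw [div_le_iff₀ (by positivity), ← sub_nonneg]
          have hkey : (1 - 1 / (36 * (m : ℝ) ^ 2) * (11 * m * Y - Z * Y)) * (m + Y) - m =
              Y / (36 * (m : ℝ) ^ 2) * (36 * m ^ 2 - (11 * m - Z) * (m + Y)) := by
            field_simp
            ring
          rw [hkey]
          refine mul_nonneg (by positivity) ?_
          rcases le_total (11 * (m : ℝ)) Z with h | h
          · nlinarith [mul_nonneg (sub_nonneg.2 h) (by positivity : 0 ≤ (m : ℝ) + Y)]
          · nlinarith [mul_nonneg (sub_nonneg.2 h) (sub_nonneg.2 hYZc), sq_nonneg (5 * (m : ℝ) - Z)]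
  refine (roundExp_mono G hpt).trans ?_
  rw [roundExp_sub_mul, roundExp_sum]
  have hw : ∀ w ∈ L, 3 * m * min 1 (nbrWeight G A w) ≤ roundExp G (fun c =>
      11 * m * cov w c - ∑ v ∈ A, (G.degree v : ℝ) * (X v c * cov w c)) := by
    intro w _
    rw [roundExp_sub, roundExp_const_mul, roundExp_sum]
    simp only [roundExp_const_mul]
    set P := roundExp G (cov w) with hP
    have hPle : min 1 (nbrWeight G A w) / 2 ≤ P := by
      refine half_le_roundExp_hit G (F w) (fun v => {s v})
        (le_min zero_le_one (nbrWeight_nonneg G A w)) (min_le_left _ _) ?_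
      refine (min_le_right _ _).trans (le_of_eq ?_)
      refine Finset.sum_congr rfl fun v hv => ?_
      rw [Finset.sum_singleton, callProb_of_adj G (hs v (Finset.mem_filter.1 hv).1).2]
    have hP0 : 0 ≤ P := roundExp_nonneg G fun c => hcov0 w c
    have hpair : ∀ v ∈ A, (G.degree v : ℝ) * roundExp G (fun c => X v c * cov w c) ≤
        P + if G.Adj v w then 1 else 0 := by
      intro v hv
      have hp : callProb G v (s v) = 1 / G.degree v := callProb_of_adj G (hs v hv).2
      have hd := hdpos v hv
      split_ifs with hvw
      · have h1 : roundExp G (fun c => X v c * cov w c) ≤ 1 / G.degree v := by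
          rw [← hp, ← roundExp_call G v (s v)]
          exact roundExp_mono G fun c => mul_le_of_le_one_right (hX0 v c) (hcov1 w c)
        have h2 := mul_le_mul_of_nonneg_left h1 hd.le
        rw [mul_one_div_cancel hd.ne'] at h2
        linarith
      · have h1 : roundExp G (fun c => X v c * cov w c) = callProb G v (s v) * P :=
          roundExp_call_mul_hit G (s v) (by simp [hF, hvw]) _
        rw [h1, hp, ← mul_assoc, mul_one_div_cancel hd.ne']
        linarith
    have hsum : ∑ v ∈ A, (G.degree v : ℝ) * roundExp G (fun c => X v c * cov w c) ≤
        A.card * P + (F w).card := by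
      refine (Finset.sum_le_sum hpair).trans (le_of_eq ?_)
      rw [Finset.sum_add_distrib, Finset.sum_const, nsmul_eq_mul, Finset.sum_boole]
    have hFq : ((F w).card : ℝ) ≤ 2 * m * min 1 (nbrWeight G A w) := by
      rcases min_cases 1 (nbrWeight G A w) with ⟨h, -⟩ | ⟨h, -⟩
      · rw [h]
        have : ((F w).card : ℝ) ≤ A.card := by
          exact_mod_cast Finset.card_le_card (Finset.filter_subset _ _)
        linarith
      · rw [h, nbrWeight, Finset.mul_sum, ← nsmul_one, ← Finset.sum_const]
        refine Finset.sum_le_sum fun v hv => ?_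
        have hvA := (Finset.mem_filter.1 hv).1
        rw [mul_one_div, le_div_iff₀ (hdpos v hvA), one_mul]
        exact_mod_cast hdeg v hvA
    have h3 : (A.card : ℝ) * P ≤ m * P := mul_le_mul_of_nonneg_right hAm hP0
    nlinarith [mul_le_mul_of_nonneg_left hPle hm0'.le]
  have h4 := Finset.sum_le_sum hw
  rw [← Finset.mul_sum] at h4
  have h5 : (∑ w ∈ L, min 1 (nbrWeight G A w)) / (12 * m) =
      1 / (36 * (m : ℝ) ^ 2) * (3 * m * ∑ w ∈ L, min 1 (nbrWeight G A w)) := by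
    field_simp
    ring
  rw [h5]
  exact sub_le_sub_left (mul_le_mul_of_nonneg_left h4 (by positivity)) _

/-! ### Selection of a self-supporting part of the boundary -/

lemma nbrWeight_mono {A B : Finset V} (h : A ⊆ B) (w : V) : nbrWeight G A w ≤ nbrWeight G B w :=
  Finset.sum_le_sum_of_subset_of_nonneg (Finset.filter_subset_filter _ h) fun _ _ _ => by positivity

lemma nbrWeight_erase {A : Finset V} {v : V} (hv : v ∈ A) {w : V} (hvw : G.Adj v w) :
    nbrWeight G (A.erase v) w = nbrWeight G A w - 1 / G.degree v := by
  rw [nbrWeight, nbrWeight, Finset.filter_erase, eq_sub_iff_add_eq]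
  exact Finset.sum_erase_add _ _ (Finset.mem_filter.2 ⟨hv, hvw⟩)

/-- If few nodes outside `S ∪ B` are within reach of `B`, in the sense of the sum on the right, then
all but a few nodes of `B` form a set `A` such that every `v ∈ A` has most of its neighbors in `S`,
in `A`, or among the nodes that `A` contacts often. The set `A` minimizes the total weight it leaves
outside, at a cost of `1 / 4` for each node of `B` that is given up: giving up a node `v` with too
many neighbors of low weight would pay. -/
lemma exists_self_supporting_subset {S B : Finset V} (hSB : Disjoint S B) :
    ∃ A ⊆ B, (∀ v ∈ A, (((G.neighborFinset v).filter fun w =>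
        w ∉ S ∧ w ∉ A ∧ nbrWeight G A w < 1 / 8).card : ℝ) ≤ 3 / 8 * G.degree v) ∧
      1 / 4 * ((B.card : ℝ) - A.card) ≤ ∑ w ∈ (S ∪ B)ᶜ, min (1 / 8) (nbrWeight G B w) := by
  obtain ⟨A, hAB, hmin⟩ := Finset.exists_min_image B.powerset
    (fun A => ∑ w ∈ (S ∪ A)ᶜ, min (1 / 8) (nbrWeight G A w) + 1 / 4 * ((B.card : ℝ) - A.card))
    ⟨B, by simp⟩
  rw [Finset.mem_powerset] at hAB
  have hm0 : ∀ (A : Finset V) w, 0 ≤ min (1 / 8) (nbrWeight G A w) :=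
    fun A w => le_min (by norm_num) (nbrWeight_nonneg G A w)
  refine ⟨A, hAB, fun v hv => ?_, ?_⟩
  · have h := hmin (A.erase v) (Finset.mem_powerset.2 ((Finset.erase_subset _ _).trans hAB))
    have hvS : v ∉ S := fun h => Finset.disjoint_left.1 hSB h (hAB hv)
    have hins : (S ∪ A.erase v)ᶜ = insert v (S ∪ A)ᶜ := by
      ext w
      simp only [Finset.mem_compl, Finset.mem_union, Finset.mem_erase, Finset.mem_insert, ne_eq]
      by_cases hw : w = v
      · subst hw; simp [hvS]
      · simp [hw]
    have hcard : ((A.erase v).card : ℝ) = A.card - 1 := by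
      rw [Finset.card_erase_of_mem hv, Nat.cast_sub (Finset.card_pos.2 ⟨v, hv⟩), Nat.cast_one]
    set U := (G.neighborFinset v).filter fun w => w ∉ S ∧ w ∉ A ∧ nbrWeight G A w < 1 / 8 with hU
    have hUsub : U ⊆ (S ∪ A)ᶜ := by
      intro w hw
      obtain ⟨-, h1, h2, -⟩ := Finset.mem_filter.1 hw
      simp [h1, h2]
    have hle : ∑ w ∈ (S ∪ A)ᶜ, min (1 / 8) (nbrWeight G (A.erase v) w) ≤
        ∑ w ∈ (S ∪ A)ᶜ, (min (1 / 8) (nbrWeight G A w) -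
          if w ∈ U then 1 / (G.degree v : ℝ) else 0) := by
      refine Finset.sum_le_sum fun w _ => ?_
      split_ifs with hwU
      · obtain ⟨h0, -, -, h3⟩ := Finset.mem_filter.1 hwU
        rw [nbrWeight_erase G hv (by simpa using h0), min_eq_right h3.le]
        exact min_le_right _ _
      · rw [sub_zero]
        exact min_le_min le_rfl (nbrWeight_mono G (Finset.erase_subset _ _) w)
    rw [Finset.sum_sub_distrib, Finset.sum_ite_mem, Finset.inter_eq_right.2 hUsub, Finset.sum_const,
      nsmul_eq_mul] at hle
    rw [hins, Finset.sum_insert (by simp [hv]), hcard] at h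
    have hv8 : min (1 / 8) (nbrWeight G (A.erase v) v) ≤ 1 / 8 := min_le_left _ _
    have hfin : (U.card : ℝ) * (1 / G.degree v) ≤ 3 / 8 := by linarith
    rcases Nat.eq_zero_or_pos (G.degree v) with h0 | h0
    · have : U.card = 0 := Nat.le_zero.1
        ((Finset.card_le_card (Finset.filter_subset _ _)).trans h0.le)
      simp [this, h0]
    · rwa [mul_one_div, div_le_iff₀ (by exact_mod_cast h0)] at hfin
  · have h := hmin B (by simp)
    have h0 : 0 ≤ ∑ w ∈ (S ∪ A)ᶜ, min (1 / 8) (nbrWeight G A w) :=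
      Finset.sum_nonneg fun w _ => hm0 A w
    linarith

/-! ### Informing the self-supporting part of the boundary -/

/-- The total inverse degree of the nodes of `R`. -/
noncomputable def invDegreeSum (R : Finset V) : ℝ := ∑ u ∈ R, 1 / (G.degree u : ℝ)

lemma invDegreeSum_mono {R R' : Finset V} (h : R ⊆ R') : invDegreeSum G R ≤ invDegreeSum G R' :=
  Finset.sum_le_sum_of_subset_of_nonneg h fun _ _ _ => by positivity

/-- For a rumor that starts in `A` and has reached `Q`: the inverse of `|Q ∩ A|`, replaced by `0` as
soon as `Q` meets `S`, or has so much inverse degree in `A` that its pulls from `S` are likely to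
succeed in the next round. -/
noncomputable def stragglerPotential (S A Q : Finset V) : ℝ :=
  if Disjoint Q S ∧ invDegreeSum G (Q ∩ A) < 1 / 16 then 1 / ((Q ∩ A).card : ℝ) else 0

lemma stragglerPotential_nonneg (S A Q : Finset V) : 0 ≤ stragglerPotential G S A Q := by
  unfold stragglerPotential
  split_ifs <;> positivity

lemma stragglerPotential_le_one (S A Q : Finset V) : stragglerPotential G S A Q ≤ 1 := by
  unfold stragglerPotential
  split_ifs
  · rw [one_div]
    exact Nat.cast_inv_le_one _
  · exact zero_le_one

lemma callProb_ge (u w : V) :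
    (if G.Adj u w then 1 / (G.degree u : ℝ) else 0) ≤ callProb G u w := by
  split_ifs with h
  · rw [callProb_of_adj G h]
  · exact callProb_nonneg G u w

/-- The nodes outside `S` and `A` that are contacted by `A` at rate at least `1 / 8`. -/
noncomputable def calledOften (S A : Finset V) : Finset V :=
  Finset.univ.filter fun w => w ∉ S ∧ w ∉ A ∧ 1 / 8 ≤ nbrWeight G A w

/-- The calls of `R ⊆ A` go mostly to `S`, `A` and the nodes that `A` contacts often, and rarely
back to `R`, whose size is small compared to the degrees of most of its nodes. -/
lemma card_le_sum_nbrWeight {S A R : Finset V} (hdeg : ∀ v ∈ A, 0 < G.degree v)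
    (hA : ∀ v ∈ A, (((G.neighborFinset v).filter fun w =>
        w ∉ S ∧ w ∉ A ∧ nbrWeight G A w < 1 / 8).card : ℝ) ≤ 3 / 8 * G.degree v)
    (hRA : R ⊆ A) (hσ : invDegreeSum G R ≤ 1 / 16) :
    9 / 16 * (R.card : ℝ) ≤ ∑ x ∈ (S ∪ A ∪ calledOften G S A) \ R, nbrWeight G R x := by
  set X := (S ∪ A ∪ calledOften G S A) \ R with hX
  have hswap : ∑ x ∈ X, nbrWeight G R x =
      ∑ u ∈ R, ((G.neighborFinset u ∩ X).card : ℝ) * (1 / G.degree u) := by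
    simp only [nbrWeight, Finset.sum_filter]
    rw [Finset.sum_comm]
    refine Finset.sum_congr rfl fun u _ => ?_
    rw [← Finset.sum_filter, Finset.sum_const, nsmul_eq_mul]
    congr 3
    ext x
    simp [and_comm]
  have hu : ∀ u ∈ R, 5 / 8 - (R.card : ℝ) * (1 / G.degree u) ≤
      ((G.neighborFinset u ∩ X).card : ℝ) * (1 / G.degree u) := by
    intro u hu
    have hd : (0 : ℝ) < G.degree u := by exact_mod_cast hdeg u (hRA hu)
    have hcover : G.neighborFinset u ⊆ (G.neighborFinset u ∩ X) ∪ ((G.neighborFinset u).filter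
        fun w => w ∉ S ∧ w ∉ A ∧ nbrWeight G A w < 1 / 8) ∪ R := by
      intro w hw
      simp only [Finset.mem_union, Finset.mem_inter, Finset.mem_filter, hX, calledOften,
        Finset.mem_sdiff, Finset.mem_univ, true_and, hw]
      rcases lt_or_ge (nbrWeight G A w) (1 / 8) with h | h
      all_goals
        simp only [h, and_true]
        tauto
    have hc1 := (Finset.card_le_card hcover).trans ((Finset.card_union_le _ _).trans
      (Nat.add_le_add_right (Finset.card_union_le _ _) _))
    rw [SimpleGraph.card_neighborFinset_eq_degree] at hc1
    have hc2 : (G.degree u : ℝ) ≤ ((G.neighborFinset u ∩ X).card : ℝ) +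
        (((G.neighborFinset u).filter
          fun w => w ∉ S ∧ w ∉ A ∧ nbrWeight G A w < 1 / 8).card : ℝ) + (R.card : ℝ) := by
      exact_mod_cast hc1
    have hc3 := hA u (hRA hu)
    rw [mul_one_div, mul_one_div, le_div_iff₀ hd, sub_mul, div_mul_cancel₀ _ hd.ne']
    linarith
  rw [hswap]
  refine le_trans ?_ (Finset.sum_le_sum hu)
  rw [Finset.sum_sub_distrib, Finset.sum_const, nsmul_eq_mul, ← Finset.mul_sum]
  change 9 / 16 * (R.card : ℝ) ≤ (R.card : ℝ) * (5 / 8) - (R.card : ℝ) * invDegreeSum G R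
  nlinarith

/-- In two rounds a rumor in `Q` grows within `A` by a constant factor in expectation, as long as
its potential is positive. The calls of `R = Q ∩ A` go mostly to new nodes of `S`, `A` and `W`,
where `W` consists of the nodes that `A` contacts often, and they rarely coincide because each node
is contacted at rate at most `1 / 16` by `R`. A node of `W` is then contacted by a new node of `A` with
constant probability in the second round, and each node of `A` contacts only one node. -/
lemma roundExp_stragglerPotential_le {S A Q : Finset V}
    (hdeg : ∀ v ∈ A, 0 < G.degree v)
    (hA : ∀ v ∈ A, (((G.neighborFinset v).filter fun w =>
        w ∉ S ∧ w ∉ A ∧ nbrWeight G A w < 1 / 8).card : ℝ) ≤ 3 / 8 * G.degree v)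
    (hQ : (Q ∩ A).Nonempty) :
    roundExp G (fun c => roundExp G fun c' =>
      stragglerPotential G S A (pushPullRound (pushPullRound Q c) c')) ≤
      511 / 512 * stragglerPotential G S A Q := by
  have hQsub : ∀ c c' : V → V, Q ⊆ pushPullRound (pushPullRound Q c) c' := fun c c' =>
    (subset_pushPullRound _ _).trans (subset_pushPullRound _ _)
  by_cases hcond : Disjoint Q S ∧ invDegreeSum G (Q ∩ A) < 1 / 16
  swap
  · have h0 : ∀ c c' : V → V,
        stragglerPotential G S A (pushPullRound (pushPullRound Q c) c') = 0 := by
      intro c c'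
      rw [stragglerPotential, if_neg]
      rintro ⟨h1, h2⟩
      exact hcond ⟨h1.mono_left (hQsub c c'),
        (invDegreeSum_mono G (Finset.inter_subset_inter_right (hQsub c c'))).trans_lt h2⟩
    simp only [h0, roundExp_const]
    exact mul_nonneg (by norm_num) (stragglerPotential_nonneg G S A Q)
  rw [show stragglerPotential G S A Q = 1 / ((Q ∩ A).card : ℝ) from if_pos hcond]
  obtain ⟨hQS, hσ⟩ := hcond
  set R := Q ∩ A with hR
  have hRA : R ⊆ A := Finset.inter_subset_right
  have hRQ : R ⊆ Q := Finset.inter_subset_left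
  set ρ : ℝ := (R.card : ℝ) with hρ
  have hρ0 : 0 < ρ := Nat.cast_pos.2 hQ.card_pos
  set W := calledOften G S A with hW
  set X : Finset V := (S ∪ A ∪ W) \ R with hX
  -- All three kinds of gain are bounded by `ρ`, so that `1 / (ρ + gain)` is bounded by a linear
  -- function of the gain.
  have hcardI : ∀ (c : V → V) (T : Finset V), ((R.image c ∩ T).card : ℝ) ≤ ρ := by
    intro c T
    exact Nat.cast_le.2 ((Finset.card_le_card Finset.inter_subset_left).trans Finset.card_image_le)
  have hhit01 : ∀ (c' : V → V) (w : V),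
      (if ∃ u ∈ A \ R, c' u ∈ ({w} : Finset V) then (1 : ℝ) else 0) ≤ 1 := by
    intro c' w
    split_ifs <;> norm_num
  have hpt : ∀ c c' : V → V,
      stragglerPotential G S A (pushPullRound (pushPullRound Q c) c') ≤
        (1 / ρ - 1 / (4 * ρ ^ 2) * ((R.image c ∩ S).card + (R.image c ∩ (A \ R)).card)) -
          1 / (4 * ρ ^ 2) * ∑ w ∈ R.image c ∩ W,
            (if ∃ u ∈ A \ R, c' u ∈ ({w} : Finset V) then (1 : ℝ) else 0) := by
    intro c c'
    set P : ℝ := ∑ w ∈ R.image c ∩ W,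
      (if ∃ u ∈ A \ R, c' u ∈ ({w} : Finset V) then (1 : ℝ) else 0) with hP
    have hPρ : P ≤ ρ := by
      refine (Finset.sum_le_sum fun w _ => hhit01 c' w).trans ?_
      simpa using hcardI c W
    have hP0 : 0 ≤ P := Finset.sum_nonneg fun w _ => by split_ifs <;> norm_num
    have hIQ : R.image c ⊆ pushPullRound Q c := by
      intro w hw
      obtain ⟨u, hu, rfl⟩ := Finset.mem_image.1 hw
      exact mem_pushPullRound.2 (Or.inr (Or.inl ⟨u, hRQ hu, rfl⟩))
    have hIQ2 : R.image c ⊆ pushPullRound (pushPullRound Q c) c' :=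
      hIQ.trans (subset_pushPullRound _ _)
    have hS1 := hcardI c S
    have hA1 := hcardI c (A \ R)
    have hrw : (1 / ρ - 1 / (4 * ρ ^ 2) * ((R.image c ∩ S).card + (R.image c ∩ (A \ R)).card)) -
        1 / (4 * ρ ^ 2) * P = (4 * ρ - ((R.image c ∩ S).card + (R.image c ∩ (A \ R)).card + P)) /
          (4 * ρ ^ 2) := by
      field_simp
      ring
    rw [hrw, stragglerPotential]
    split_ifs with h
    · have hS0 : R.image c ∩ S = ∅ :=
        Finset.disjoint_iff_inter_eq_empty.1 (h.1.mono_left hIQ2)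
      set D := (A \ R).filter fun u => c' u ∈ R.image c with hD
      have hPD : P ≤ D.card := by
        rw [hP, Finset.sum_boole]
        refine Nat.cast_le.2 (le_trans (Finset.card_le_card ?_) (Finset.card_image_le (f := c')))
        intro w hw
        obtain ⟨h1, u, hu, h2⟩ := Finset.mem_filter.1 hw
        rw [Finset.mem_singleton] at h2
        refine Finset.mem_image.2 ⟨u, Finset.mem_filter.2 ⟨hu, ?_⟩, h2⟩
        rw [h2]
        exact (Finset.mem_inter.1 h1).1
      have hgrow : ∀ T ⊆ A \ R, T ⊆ pushPullRound (pushPullRound Q c) c' →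
          ρ + T.card ≤ ((pushPullRound (pushPullRound Q c) c' ∩ A).card : ℝ) := by
        intro T hT hT'
        rw [hρ]
        norm_cast
        rw [← Finset.card_union_of_disjoint]
        · refine Finset.card_le_card (Finset.union_subset ?_ ?_)
          · exact Finset.subset_inter (hRQ.trans (hQsub c c')) hRA
          · exact Finset.subset_inter hT' (hT.trans Finset.sdiff_subset)
        · exact Finset.disjoint_left.2 fun u hu hu' => (Finset.mem_sdiff.1 (hT hu')).2 hu
      have hg1 := hgrow (R.image c ∩ (A \ R)) Finset.inter_subset_right
        (Finset.inter_subset_left.trans hIQ2)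
      have hg2 := hgrow D (Finset.filter_subset _ _) (by
        intro u hu
        exact mem_pushPullRound.2 (Or.inr (Or.inr (hIQ (Finset.mem_filter.1 hu).2))))
      set a : ℝ := ((R.image c ∩ (A \ R)).card : ℝ) with ha
      have ha0 : 0 ≤ a := by positivity
      have hg : ρ + (a + P) / 2 ≤ ((pushPullRound (pushPullRound Q c) c' ∩ A).card : ℝ) := by
        linarith
      refine (one_div_le_one_div_of_le (by positivity) hg).trans ?_
      rw [hS0, Finset.card_empty, Nat.cast_zero, zero_add, div_le_div_iff₀ (by positivity)
        (by positivity)]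
      nlinarith [mul_nonneg (add_nonneg ha0 hP0) (by linarith : 0 ≤ 2 * ρ - (a + P))]
    · refine div_nonneg ?_ (by positivity)
      linarith
  -- Expectation over the second round: a node of `W` is contacted by `A \ R` at rate at least
  -- `1 / 8 - 1 / 16`.
  have hsecond : ∀ c : V → V, roundExp G (fun c' =>
      stragglerPotential G S A (pushPullRound (pushPullRound Q c) c')) ≤
        1 / ρ - 1 / (128 * ρ ^ 2) * ∑ x ∈ X,
          (if ∃ u ∈ R, c u ∈ ({x} : Finset V) then (1 : ℝ) else 0) := by
    intro c
    refine (roundExp_mono G (hpt c)).trans ?_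
    rw [roundExp_sub_mul, roundExp_sum]
    have hw : ∀ w ∈ R.image c ∩ W, (1 / 32 : ℝ) ≤ roundExp G (fun c' =>
        if ∃ u ∈ A \ R, c' u ∈ ({w} : Finset V) then (1 : ℝ) else 0) := by
      intro w hw
      have hwW := (Finset.mem_filter.1 (hW ▸ (Finset.mem_inter.1 hw).2)).2.2.2
      have h := half_le_roundExp_hit G (A \ R) (fun _ => {w}) (x := 1 / 16) (by norm_num)
        (by norm_num) ?_
      · linarith
      · simp only [Finset.sum_singleton]
        refine le_trans ?_ (Finset.sum_le_sum fun u _ => callProb_ge G u w)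
        rw [nbrWeight, Finset.sum_filter, ← Finset.sum_sdiff hRA] at hwW
        have hle : ∑ u ∈ R, (if G.Adj u w then 1 / (G.degree u : ℝ) else 0) ≤ invDegreeSum G R := by
          refine Finset.sum_le_sum fun u _ => ?_
          split_ifs
          exacts [le_rfl, by positivity]
        linarith
    have hws := Finset.sum_le_sum hw
    rw [Finset.sum_const, nsmul_eq_mul] at hws
    have hXI : ∑ x ∈ X, (if ∃ u ∈ R, c u ∈ ({x} : Finset V) then (1 : ℝ) else 0) ≤
        (R.image c ∩ S).card + (R.image c ∩ (A \ R)).card + (R.image c ∩ W).card := by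
      rw [Finset.sum_boole]
      norm_cast
      refine le_trans (Finset.card_le_card (t := (R.image c ∩ S) ∪ (R.image c ∩ (A \ R)) ∪
        (R.image c ∩ W)) ?_) ?_
      · intro x hx
        obtain ⟨hxX, u, hu, hc⟩ := Finset.mem_filter.1 hx
        have hxI : x ∈ R.image c := Finset.mem_image.2 ⟨u, hu, Finset.mem_singleton.1 hc⟩
        simp only [hX, Finset.mem_sdiff, Finset.mem_union] at hxX
        simp only [Finset.mem_union, Finset.mem_inter, Finset.mem_sdiff]
        tauto
      · exact (Finset.card_union_le _ _).trans (Nat.add_le_add_right (Finset.card_union_le _ _) _)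
    have hcoef : (1 : ℝ) / (128 * ρ ^ 2) = 1 / (4 * ρ ^ 2) * (1 / 32) := by
      field_simp
      norm_num
    have hn1 : (0 : ℝ) ≤ (R.image c ∩ S).card := by positivity
    have hn2 : (0 : ℝ) ≤ (R.image c ∩ (A \ R)).card := by positivity
    rw [hcoef, mul_assoc, sub_sub, ← mul_add]
    refine sub_le_sub_left (mul_le_mul_of_nonneg_left ?_ (by positivity)) _
    linarith
  -- Expectation over the first round: by `hσ`, each node is contacted by `R` at a rate below `1`,
  -- so that the hitting probability is at least half of the rate.
  refine (roundExp_mono G hsecond).trans ?_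
  rw [roundExp_sub_mul, roundExp_sum]
  have hx : ∀ x ∈ X, nbrWeight G R x / 2 ≤ roundExp G (fun c =>
      if ∃ u ∈ R, c u ∈ ({x} : Finset V) then (1 : ℝ) else 0) := by
    intro x _
    have hle : nbrWeight G R x ≤ invDegreeSum G R :=
      Finset.sum_le_sum_of_subset_of_nonneg (Finset.filter_subset _ _) fun _ _ _ => by positivity
    refine half_le_roundExp_hit G R (fun _ => {x}) (nbrWeight_nonneg G R x) (by linarith) ?_
    simp only [Finset.sum_singleton]
    rw [nbrWeight, Finset.sum_filter]
    exact Finset.sum_le_sum fun u _ => callProb_ge G u x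
  have hxs := Finset.sum_le_sum hx
  have hflow : 9 / 16 * ρ ≤ ∑ x ∈ X, nbrWeight G R x :=
    card_le_sum_nbrWeight G hdeg hA hRA hσ.le
  rw [← Finset.sum_div] at hxs
  have hcoef : 511 / 512 * (1 / ρ) = 1 / ρ - 1 / (128 * ρ ^ 2) * (ρ / 4) := by
    field_simp
    ring
  rw [hcoef]
  refine sub_le_sub_left (mul_le_mul_of_nonneg_left ?_ (by positivity)) _
  linarith

lemma callsExp_stragglerPotential_le {S A Q : Finset V}
    (hdeg : ∀ v ∈ A, 0 < G.degree v)
    (hA : ∀ v ∈ A, (((G.neighborFinset v).filter fun w =>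
        w ∉ S ∧ w ∉ A ∧ nbrWeight G A w < 1 / 8).card : ℝ) ≤ 3 / 8 * G.degree v)
    (hQ : (Q ∩ A).Nonempty) (J : ℕ) :
    callsExp G (2 * J) (fun l => stragglerPotential G S A (spread Q l)) ≤
      (511 / 512) ^ J * stragglerPotential G S A Q := by
  induction J generalizing Q with
  | zero => simp [callsExp, spread]
  | succ J ih =>
    have hstep : ∀ c c' : V → V, callsExp G (2 * J)
        (fun l => stragglerPotential G S A (spread Q (c :: c' :: l))) ≤
        (511 / 512) ^ J * stragglerPotential G S A (pushPullRound (pushPullRound Q c) c') := by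
      intro c c'
      exact ih (hQ.mono (Finset.inter_subset_inter_right
        ((subset_pushPullRound _ _).trans (subset_pushPullRound _ _))))
    rw [show 2 * (J + 1) = 2 * J + 1 + 1 by ring]
    simp only [callsExp]
    refine (roundExp_mono G fun c => roundExp_mono G fun c' => hstep c c').trans ?_
    simp only [roundExp_const_mul]
    rw [pow_succ, mul_assoc]
    exact mul_le_mul_of_nonneg_left (roundExp_stragglerPotential_le G hdeg hA hQ)
      (by positivity)

/-- A node `v` of a self-supporting part `A` of the boundary is informed with constant probability:
in reversed time, the rumor grows from `v` until it meets `S` or its pulls are likely to do so. -/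
lemma callsExp_mem_spread_ge {S A : Finset V} (hAS : A ⊆ boundary G S)
    (hA : ∀ v ∈ A, (((G.neighborFinset v).filter fun w =>
        w ∉ S ∧ w ∉ A ∧ nbrWeight G A w < 1 / 8).card : ℝ) ≤ 3 / 8 * G.degree v)
    {Δ : ℕ} (hΔ : ∀ v, G.degree v ≤ Δ) {J : ℕ} (hJ : (Δ : ℝ) * (511 / 512) ^ J ≤ 1)
    {v : V} (hv : v ∈ A) :
    1 / 64 ≤ callsExp G (2 * J + 1) (fun l => if v ∈ spread S l then 1 else 0) := by
  have hnbr : ∀ u ∈ A, ∃ a ∈ S, G.Adj u a := fun u hu => by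
    obtain ⟨-, a, ha, hau⟩ := (mem_boundary G).1 (hAS hu)
    exact ⟨a, ha, hau.symm⟩
  have hdeg : ∀ u ∈ A, 0 < G.degree u := fun u hu => by
    obtain ⟨a, -, hua⟩ := hnbr u hu
    exact (G.degree_pos_iff_exists_adj u).2 ⟨a, hua⟩
  have hΔ0 : (0 : ℝ) < Δ := by exact_mod_cast (hdeg v hv).trans_le (hΔ v)
  rw [← callsExp_reverse]
  have hrev : ∀ l : List (V → V), (v ∈ spread S l.reverse) ↔ ∃ u ∈ spread {v} l, u ∈ S := by
    intro l
    rw [spread_meets_iff]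
    simp
  simp only [hrev]
  rw [callsExp_succ_append]
  have hlast : ∀ l : List (V → V), 1 / 32 - Δ / 512 * stragglerPotential G S A (spread {v} l) ≤
      roundExp G (fun c => if ∃ u ∈ spread {v} (l ++ [c]), u ∈ S then 1 else 0) := by
    intro l
    set Q := spread {v} l with hQdef
    have hh0 := stragglerPotential_nonneg G S A Q
    have hsub : 1 / 32 - Δ / 512 * stragglerPotential G S A Q ≤ 1 / 32 :=
      sub_le_self _ (by positivity)
    simp only [spread_append, ← hQdef]
    by_cases hQS : Disjoint Q S
    · by_cases hσ : invDegreeSum G (Q ∩ A) < 1 / 16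
      · have hv' : v ∈ Q ∩ A :=
          Finset.mem_inter.2 ⟨subset_spread _ _ (Finset.mem_singleton_self v), hv⟩
        have hc0 : (0 : ℝ) < (Q ∩ A).card := by exact_mod_cast Finset.card_pos.2 ⟨v, hv'⟩
        have hcard : (Q ∩ A).card * (1 / (Δ : ℝ)) ≤ invDegreeSum G (Q ∩ A) := by
          rw [← nsmul_eq_mul, ← Finset.sum_const]
          refine Finset.sum_le_sum fun u hu => one_div_le_one_div_of_le ?_ ?_
          · exact_mod_cast hdeg u (Finset.mem_inter.1 hu).2
          · exact_mod_cast hΔ u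
        refine le_trans ?_ (roundExp_nonneg G fun c => by split_ifs <;> norm_num)
        rw [stragglerPotential, if_pos ⟨hQS, hσ⟩]
        have h16 : ((Q ∩ A).card : ℝ) ≤ Δ / 16 := by
          have := hcard.trans hσ.le
          rw [mul_one_div, div_le_iff₀ hΔ0] at this
          linarith
        have h1 : (1 : ℝ) / 32 ≤ Δ / 512 * (1 / (Q ∩ A).card) := by
          rw [mul_one_div, le_div_iff₀ hc0]
          linarith
        linarith
      · refine hsub.trans ?_
        have hhit := half_le_roundExp_hit G (Q ∩ A) (fun _ => S) (x := 1 / 16) (by norm_num)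
          (by norm_num) ?_
        · refine le_trans (by linarith) (hhit.trans (roundExp_mono G fun c => ?_))
          split_ifs with h1 h2
          · exact le_rfl
          · obtain ⟨u, hu, hc⟩ := h1
            exact absurd ⟨c u, mem_pushPullRound.2
              (Or.inr (Or.inl ⟨u, (Finset.mem_inter.1 hu).1, rfl⟩)), hc⟩ h2
          · exact zero_le_one
          · exact le_rfl
        · refine (not_lt.1 hσ).trans (Finset.sum_le_sum fun u hu => ?_)
          obtain ⟨a, ha, hua⟩ := hnbr u (Finset.mem_inter.1 hu).2
          rw [← callProb_of_adj G hua]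
          exact Finset.single_le_sum (f := fun a => callProb G u a)
            (fun a _ => callProb_nonneg G u a) ha
    · refine hsub.trans ?_
      obtain ⟨u, hu, huS⟩ := Finset.not_disjoint_iff.1 hQS
      have h1 : ∀ c : V → V,
          (if ∃ u ∈ spread Q [c], u ∈ S then (1 : ℝ) else 0) = 1 := fun c =>
        if_pos ⟨u, subset_spread Q [c] hu, huS⟩
      simp only [h1, roundExp_const]
      norm_num
  refine le_trans ?_ (callsExp_mono G hlast)
  rw [callsExp_sub, callsExp_const, callsExp_const_mul]
  have hexp := callsExp_stragglerPotential_le G hdeg hA (Q := {v})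
    ⟨v, by simp [hv]⟩ J
  have h1 : (511 / 512 : ℝ) ^ J * stragglerPotential G S A {v} ≤ (511 / 512) ^ J * 1 :=
    mul_le_mul_of_nonneg_left (stragglerPotential_le_one G S A {v}) (by positivity)
  have h2 := mul_le_mul_of_nonneg_left (hexp.trans h1) (by positivity : (0 : ℝ) ≤ Δ / 512)
  have h3 : (Δ : ℝ) / 512 * ((511 / 512) ^ J * 1) ≤ 1 / 512 := by linarith
  linarith

/-- If each node of `A` is informed with constant probability, then the expected gain in informed
nodes is of order `|A|`; it is capped at `|A|`, so that the inverse of their number shrinks too. -/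
lemma callsExp_card_spread_le {S A : Finset V} (hS : S.Nonempty) (hSA : Disjoint S A) {t : ℕ}
    {p : ℝ} (hp : ∀ v ∈ A, p ≤ callsExp G t (fun l => if v ∈ spread S l then 1 else 0)) :
    callsExp G t (fun l => (S.card : ℝ) / (spread S l).card) ≤
      1 - p * A.card / (S.card + A.card) := by
  have hs0 : (0 : ℝ) < S.card := by exact_mod_cast hS.card_pos
  have hpt : ∀ l : List (V → V), (S.card : ℝ) / (spread S l).card ≤
      1 - 1 / ((S.card : ℝ) + A.card) * ∑ v ∈ A, (if v ∈ spread S l then 1 else 0) := by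
    intro l
    rw [Finset.sum_boole, Finset.filter_mem_eq_inter]
    set g : ℝ := ((A ∩ spread S l).card : ℝ) with hg
    have hgA : g ≤ A.card := Nat.cast_le.2 (Finset.card_le_card Finset.inter_subset_left)
    have hg0 : 0 ≤ g := by positivity
    have hle : S.card + g ≤ (spread S l).card := by
      rw [hg]
      norm_cast
      rw [← Finset.card_union_of_disjoint (hSA.mono_right Finset.inter_subset_left)]
      exact Finset.card_le_card (Finset.union_subset (subset_spread S l) Finset.inter_subset_right)
    refine (div_le_div_of_nonneg_left hs0.le (by positivity) hle).trans ?_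
    have h1 : (S.card : ℝ) / (S.card + g) = 1 - g / (S.card + g) := by
      field_simp
      ring
    rw [h1, one_div_mul_eq_div]
    exact sub_le_sub_left (div_le_div_of_nonneg_left hg0 (by positivity) (by linarith)) _
  refine (callsExp_mono G hpt).trans ?_
  rw [callsExp_sub, callsExp_const, callsExp_const_mul, callsExp_sum, one_div_mul_eq_div]
  refine sub_le_sub_left (div_le_div_of_nonneg_right ?_ (by positivity)) _
  have := Finset.sum_le_sum hp
  rw [Finset.sum_const, nsmul_eq_mul] at this
  linarith

/-! ### The potential of the set of informed nodes -/

/-- The inverse of `|S| |S ∪ ∂S|`. -/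
noncomputable def spreadPotential (S : Finset V) : ℝ :=
  1 / ((S.card : ℝ) * (closedNbhd G S).card)

lemma spreadPotential_nonneg (S : Finset V) : 0 ≤ spreadPotential G S := by
  unfold spreadPotential
  positivity

lemma card_closedNbhd_pos {S : Finset V} (hS : S.Nonempty) : 0 < (closedNbhd G S).card := by
  have := hS.card_pos
  have := card_closedNbhd G S
  omega

lemma spreadPotential_le_of_subset {S T : Finset V} (hS : S.Nonempty) (hST : S ⊆ T) :
    spreadPotential G T ≤ 1 / S.card * (1 / (closedNbhd G T).card) := by
  have h1 : (0 : ℝ) < S.card := by exact_mod_cast hS.card_pos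
  have h2 : (0 : ℝ) < (closedNbhd G T).card := by
    exact_mod_cast card_closedNbhd_pos G (hS.mono hST)
  have h3 : (S.card : ℝ) ≤ T.card := by exact_mod_cast Finset.card_le_card hST
  rw [spreadPotential, one_div_mul_one_div]
  exact one_div_le_one_div_of_le (by positivity) (by gcongr)

lemma spreadPotential_anti {S T : Finset V} (hS : S.Nonempty) (hST : S ⊆ T) :
    spreadPotential G T ≤ spreadPotential G S := by
  have h1 : (0 : ℝ) < S.card := by exact_mod_cast hS.card_pos
  have h2 : (0 : ℝ) < (closedNbhd G S).card := by exact_mod_cast card_closedNbhd_pos G hS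
  refine (spreadPotential_le_of_subset G hS hST).trans ?_
  rw [spreadPotential, one_div_mul_one_div]
  refine one_div_le_one_div_of_le (by positivity) ?_
  gcongr
  exact closedNbhd_mono G hST

lemma callsExp_spreadPotential_le_of_closedNbhd {S : Finset V} (hS : S.Nonempty) (J : ℕ) {x : ℝ}
    (h : roundExp G (fun c => ((closedNbhd G S).card : ℝ) /
      (closedNbhd G (pushPullRound S c)).card) ≤ 1 - x) :
    callsExp G (J + 1) (fun l => spreadPotential G (spread S l)) ≤
      (1 - x) * spreadPotential G S := by
  have hm : (0 : ℝ) < (closedNbhd G S).card := by exact_mod_cast card_closedNbhd_pos G hS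
  have hc : ∀ c : V → V, callsExp G J (fun l => spreadPotential G (spread S (c :: l))) ≤
      spreadPotential G S * (((closedNbhd G S).card : ℝ) /
        (closedNbhd G (pushPullRound S c)).card) := by
    intro c
    have hne := hS.mono (subset_pushPullRound S c)
    have h1 := callsExp_mono G (t := J) (F := fun l => spreadPotential G (spread S (c :: l)))
      (F' := fun _ => spreadPotential G (pushPullRound S c))
      (fun l => spreadPotential_anti G hne (subset_spread _ l))
    rw [callsExp_const] at h1
    refine h1.trans ((spreadPotential_le_of_subset G hS (subset_pushPullRound S c)).trans
      (le_of_eq ?_))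
    rw [spreadPotential]
    field_simp
  refine (roundExp_mono G hc).trans ?_
  rw [roundExp_const_mul, mul_comm]
  exact mul_le_mul_of_nonneg_right h (spreadPotential_nonneg G S)

lemma callsExp_spreadPotential_le_of_card {S : Finset V} (hS : S.Nonempty) (t : ℕ) {x : ℝ}
    (h : callsExp G t (fun l => (S.card : ℝ) / (spread S l).card) ≤ 1 - x) :
    callsExp G t (fun l => spreadPotential G (spread S l)) ≤ (1 - x) * spreadPotential G S := by
  have h1 : (0 : ℝ) < S.card := by exact_mod_cast hS.card_pos
  have h2 : (0 : ℝ) < (closedNbhd G S).card := by exact_mod_cast card_closedNbhd_pos G hS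
  have hl : ∀ l : List (V → V), spreadPotential G (spread S l) ≤
      spreadPotential G S * ((S.card : ℝ) / (spread S l).card) := by
    intro l
    have h3 : (0 : ℝ) < (spread S l).card := by
      exact_mod_cast (hS.mono (subset_spread S l)).card_pos
    have h4 : spreadPotential G S * ((S.card : ℝ) / (spread S l).card) =
        1 / ((spread S l).card * (closedNbhd G S).card) := by
      rw [spreadPotential]
      field_simp
    rw [h4]
    refine one_div_le_one_div_of_le (by positivity) ?_
    gcongr
    exact closedNbhd_mono G (subset_spread S l)
  refine (callsExp_mono G hl).trans ?_
  rw [callsExp_const_mul, mul_comm]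
  exact mul_le_mul_of_nonneg_right h (spreadPotential_nonneg G S)

/-- Within `O(log Δ)` rounds, the potential of a set with large boundary drops by a factor of
`1 - Ω(α)` in expectation: either the closed neighborhood grows at once, or most of the boundary is
self-supporting and is informed with constant probability. -/
lemma callsExp_spreadPotential_le {S : Finset V} (hS : S.Nonempty) {α : ℝ} (hα2 : α ≤ 2)
    (hB : α * S.card ≤ (boundary G S).card) {Δ : ℕ} (hΔ : ∀ v, G.degree v ≤ Δ) {J : ℕ}
    (hJ : (Δ : ℝ) * (511 / 512) ^ J ≤ 1) :
    callsExp G (2 * J + 1) (fun l => spreadPotential G (spread S l)) ≤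
      (1 - α / 2304) * spreadPotential G S := by
  set B := boundary G S with hBdef
  set m := (closedNbhd G S).card with hm
  have hs : (0 : ℝ) < S.card := by exact_mod_cast hS.card_pos
  have hmsum : (m : ℝ) = S.card + B.card := by exact_mod_cast card_closedNbhd G S
  have hb : (0 : ℝ) ≤ B.card := by positivity
  have hm0 : (0 : ℝ) < m := by linarith
  have hrate : α / 2304 ≤ B.card / (768 * m) := by
    rw [div_le_div_iff₀ (by norm_num) (by positivity), hmsum]
    nlinarith
  suffices h : callsExp G (2 * J + 1) (fun l => spreadPotential G (spread S l)) ≤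
      (1 - B.card / (768 * m)) * spreadPotential G S from
    h.trans (mul_le_mul_of_nonneg_right (sub_le_sub_left hrate _) (spreadPotential_nonneg G S))
  set H := B.filter fun v => 2 * m ≤ G.degree v with hH
  set M := B.filter fun v => ¬ 2 * m ≤ G.degree v with hM
  have hHM : (H.card : ℝ) + M.card = B.card := by
    exact_mod_cast Finset.card_filter_add_card_filter_not (s := B) fun v => 2 * m ≤ G.degree v
  by_cases hHB : (B.card : ℝ) / 2 ≤ H.card
  · refine callsExp_spreadPotential_le_of_closedNbhd G hS (2 * J)
      ((roundExp_closedNbhd_le_of_large_degree G hS (H := H) (Finset.filter_subset _ _)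
        fun v hv => (Finset.mem_filter.1 hv).2).trans (sub_le_sub_left ?_ _))
    rw [← hm, div_le_div_iff₀ (by positivity) (by positivity)]
    nlinarith
  have hMdeg : ∀ v ∈ M, G.degree v ≤ 2 * m := fun v hv => by
    have := (Finset.mem_filter.1 hv).2
    omega
  by_cases hL : (B.card : ℝ) / 64 ≤ ∑ w ∈ (closedNbhd G S)ᶜ, min 1 (nbrWeight G M w)
  · refine callsExp_spreadPotential_le_of_closedNbhd G hS (2 * J)
      ((roundExp_closedNbhd_le_of_small_degree G hS (A := M) (Finset.filter_subset _ _)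
        hMdeg).trans (sub_le_sub_left ?_ _))
    rw [← hm, div_le_div_iff₀ (by positivity) (by positivity)]
    nlinarith
  have hSM : Disjoint S M := Finset.disjoint_left.2 fun v hv hv' =>
    ((mem_boundary G).1 (Finset.mem_filter.1 hv').1).1 hv
  obtain ⟨A, hAM, hA, hcard⟩ := exists_self_supporting_subset G hSM
  have hAB : A ⊆ B := hAM.trans (Finset.filter_subset _ _)
  have hout : ∑ w ∈ (S ∪ M)ᶜ, min (1 / 8) (nbrWeight G M w) ≤
      ∑ w ∈ (closedNbhd G S)ᶜ, min 1 (nbrWeight G M w) + H.card / 8 := by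
    have hsub : (S ∪ M)ᶜ ⊆ (closedNbhd G S)ᶜ ∪ H := by
      intro w
      simp only [closedNbhd, Finset.mem_compl, Finset.mem_union, hH, hM, Finset.mem_filter, ← hBdef]
      tauto
    have h0 : ∀ w, 0 ≤ min (1 / 8) (nbrWeight G M w) :=
      fun w => le_min (by norm_num) (nbrWeight_nonneg G M w)
    have hdisj : Disjoint (closedNbhd G S)ᶜ H := by
      refine Finset.disjoint_left.2 fun w hw hw' => Finset.mem_compl.1 hw ?_
      exact Finset.mem_union_right _ (Finset.mem_filter.1 hw').1
    refine (Finset.sum_le_sum_of_subset_of_nonneg hsub fun w _ _ => h0 w).trans ?_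
    rw [Finset.sum_union hdisj]
    refine add_le_add (Finset.sum_le_sum fun w _ => min_le_min (by norm_num) le_rfl) ?_
    refine (Finset.sum_le_sum fun w _ => min_le_left _ _).trans (le_of_eq ?_)
    rw [Finset.sum_const, nsmul_eq_mul, mul_one_div]
  have hAb : (B.card : ℝ) / 8 ≤ A.card := by linarith
  have hSA : Disjoint S A := hSM.mono_right hAM
  refine callsExp_spreadPotential_le_of_card G hS _ ((callsExp_card_spread_le G hS hSA
    fun v hv => callsExp_mem_spread_ge G hAB hA hΔ hJ hv).trans (sub_le_sub_left ?_ _))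
  rw [hmsum, div_le_div_iff₀ (by positivity) (by positivity)]
  nlinarith [mul_le_mul_of_nonneg_right hAb hs.le, mul_le_mul_of_nonneg_right hAb hb,
    mul_nonneg hb (Nat.cast_nonneg A.card : (0 : ℝ) ≤ A.card)]

/-! ### Informing half of the nodes, and then all of them -/

/-- If the potential of every set of at most half of the nodes drops by a factor `q` in `T` rounds,
then it is unlikely that only half of the nodes are informed after `k T` rounds. -/
lemma callsExp_half_le {T : ℕ} {q : ℝ} (hq : 0 ≤ q)
    (h : ∀ S : Finset V, S.Nonempty → 2 * S.card ≤ Fintype.card V →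
      callsExp G T (fun l => spreadPotential G (spread S l)) ≤ q * spreadPotential G S)
    (k : ℕ) (s : V) :
    callsExp G (k * T) (fun l => if 2 * (spread {s} l).card ≤ Fintype.card V then 1 else 0) ≤
      (Fintype.card V : ℝ) ^ 2 * q ^ k := by
  set n := Fintype.card V with hn
  set stopped : Finset V → ℝ := fun S => if 2 * S.card ≤ n then spreadPotential G S else 0
    with hstopped
  have hst0 : ∀ S, 0 ≤ stopped S := fun S => by
    simp only [hstopped]
    split_ifs
    exacts [spreadPotential_nonneg G S, le_rfl]
  have hst1 : ∀ S, stopped S ≤ spreadPotential G S := fun S => by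
    simp only [hstopped]
    split_ifs
    exacts [le_rfl, spreadPotential_nonneg G S]
  have hone : ∀ S : Finset V, S.Nonempty →
      callsExp G T (fun l => stopped (spread S l)) ≤ q * stopped S := by
    intro S hS
    by_cases hSn : 2 * S.card ≤ n
    · refine (callsExp_mono G fun l => hst1 _).trans ((h S hS hSn).trans (le_of_eq ?_))
      simp [hstopped, hSn]
    · have h0 : ∀ l, stopped (spread S l) = 0 := fun l => by
        refine if_neg fun hl => hSn (le_trans ?_ hl)
        exact Nat.mul_le_mul_left 2 (Finset.card_le_card (subset_spread S l))
      simp only [h0, callsExp_const]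
      exact mul_nonneg hq (hst0 S)
  have hmany : ∀ (k : ℕ) (S : Finset V), S.Nonempty →
      callsExp G (k * T) (fun l => stopped (spread S l)) ≤ q ^ k * stopped S := by
    intro k
    induction k with
    | zero => intro S _; simp [callsExp, spread]
    | succ k ih =>
      intro S hS
      rw [Nat.succ_mul, add_comm, callsExp_add_rounds]
      have h1 : ∀ l, callsExp G (k * T) (fun l' => stopped (spread S (l ++ l'))) ≤
          q ^ k * stopped (spread S l) := by
        intro l
        simp only [spread_append]
        exact ih _ (hS.mono (subset_spread S l))
      refine (callsExp_mono G h1).trans ?_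
      rw [callsExp_const_mul, pow_succ, mul_assoc]
      exact mul_le_mul_of_nonneg_left (hone S hS) (by positivity)
  have hpt : ∀ l, (if 2 * (spread {s} l).card ≤ n then (1 : ℝ) else 0) ≤
      (n : ℝ) ^ 2 * stopped (spread {s} l) := by
    intro l
    simp only [hstopped]
    split_ifs with hl
    · have hne : (spread {s} l).Nonempty := (Finset.singleton_nonempty s).mono (subset_spread _ l)
      have h1 : (0 : ℝ) < (spread {s} l).card := by exact_mod_cast hne.card_pos
      have h2 : (0 : ℝ) < (closedNbhd G (spread {s} l)).card := by
        exact_mod_cast card_closedNbhd_pos G hne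
      have h3 : ((spread {s} l).card : ℝ) ≤ n := by exact_mod_cast Finset.card_le_univ _
      have h4 : ((closedNbhd G (spread {s} l)).card : ℝ) ≤ n := by
        exact_mod_cast Finset.card_le_univ _
      rw [spreadPotential, mul_one_div, le_div_iff₀ (by positivity), one_mul, sq]
      gcongr
    · simp
  refine (callsExp_mono G hpt).trans ?_
  rw [callsExp_const_mul]
  refine mul_le_mul_of_nonneg_left ((hmany k {s} (Finset.singleton_nonempty s)).trans ?_)
    (by positivity)
  refine mul_le_of_le_one_right (by positivity) ((hst1 _).trans ?_)
  rw [spreadPotential, one_div]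
  exact_mod_cast Nat.cast_inv_le_one ((({s} : Finset V)).card * (closedNbhd G {s}).card)

/-- If from every node more than half of the nodes are reached in `t` rounds, up to probability
`δ`, then by time reversal every pair of nodes meets in the middle of `2 t` rounds. -/
lemma callsExp_spread_eq_univ_ge {t : ℕ} {δ : ℝ}
    (h : ∀ v, callsExp G t
      (fun l => if 2 * (spread {v} l).card ≤ Fintype.card V then 1 else 0) ≤ δ) (s : V) :
    1 - Fintype.card V * (2 * δ) ≤
      callsExp G (t + t) (fun l => if spread {s} l = Finset.univ then 1 else 0) := by
  set n := Fintype.card V with hn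
  set low : V → List (V → V) → ℝ := fun v l => if 2 * (spread {v} l).card ≤ n then 1 else 0
    with hlow
  have hlow0 : ∀ v l, 0 ≤ low v l := fun v l => by
    simp only [hlow]
    split_ifs <;> norm_num
  have hpt : ∀ l l' : List (V → V), 1 - ∑ v, (low s l - (-1) * low v l'.reverse) ≤
      if spread {s} (l ++ l') = Finset.univ then 1 else 0 := by
    intro l l'
    have hterm : ∀ v, 0 ≤ low s l - (-1) * low v l'.reverse := fun v => by
      have := hlow0 s l
      have := hlow0 v l'.reverse
      linarith
    split_ifs with hu
    · have := Finset.sum_nonneg fun v (_ : v ∈ Finset.univ) => hterm v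
      linarith
    · obtain ⟨v, hv⟩ : ∃ v, v ∉ spread {s} (l ++ l') := by
        by_contra! hall
        exact hu (Finset.eq_univ_iff_forall.2 hall)
      have h1 : 1 ≤ low s l - (-1) * low v l'.reverse := by
        by_cases h2 : 2 * (spread {s} l).card ≤ n
        · have := hlow0 v l'.reverse
          have : low s l = 1 := if_pos h2
          linarith
        · by_cases h3 : 2 * (spread {v} l'.reverse).card ≤ n
          · have := hlow0 s l
            have : low v l'.reverse = 1 := if_pos h3
            linarith
          · exfalso
            have hmeet : ∃ u ∈ spread {s} l, u ∈ spread {v} l'.reverse := by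
              by_contra! hd
              have hdis : Disjoint (spread {s} l) (spread {v} l'.reverse) :=
                Finset.disjoint_left.2 hd
              have := Finset.card_union_of_disjoint hdis
              have := Finset.card_le_univ (spread {s} l ∪ spread {v} l'.reverse)
              omega
            rw [← spread_meets_iff, ← spread_append] at hmeet
            obtain ⟨u, hu, huv⟩ := hmeet
            rw [Finset.mem_singleton] at huv
            exact hv (huv ▸ hu)
      have := Finset.single_le_sum (f := fun v => low s l - (-1) * low v l'.reverse)
        (fun v _ => hterm v) (Finset.mem_univ v)
      linarith
  rw [callsExp_add_rounds]
  refine le_trans ?_ (callsExp_mono G fun l => callsExp_mono G (hpt l))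
  simp only [callsExp_sub, callsExp_const, callsExp_sum, callsExp_const_mul]
  have hrev : ∀ v, callsExp G t (fun l => low v l.reverse) ≤ δ := fun v => by
    rw [callsExp_reverse G t (low v)]
    exact h v
  have hsum : ∑ v, (callsExp G t (low s) - -1 * callsExp G t fun l => low v l.reverse) ≤
      ∑ _v : V, 2 * δ := by
    refine Finset.sum_le_sum fun v _ => ?_
    have := h s
    have := hrev v
    linarith
  rw [Finset.sum_const, nsmul_eq_mul, Finset.card_univ] at hsum
  linarith

/-! ### The law of the contacts -/

lemma callsExp_eq_sum (t : ℕ) (F : List (V → V) → ℝ) :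
    callsExp G t F = ∑ a : Fin t → V → V, (∏ i, roundWeight G (a i)) * F (List.ofFn a) := by
  induction t generalizing F with
  | zero => simp [callsExp]
  | succ t ih =>
    simp only [callsExp, roundExp, ih, Finset.mul_sum]
    rw [← Fintype.sum_prod_type', ← (Fin.consEquiv fun _ : Fin (t + 1) => V → V).sum_comp]
    refine Finset.sum_congr rfl fun a _ => ?_
    simp [Fin.consEquiv, Fin.prod_univ_succ, List.ofFn_succ, mul_assoc]

section Measure

variable [MeasurableSpace V] [DiscreteMeasurableSpace V]

instance : IsProbabilityMeasure (contactMeasure G) := by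
  unfold contactMeasure
  infer_instance

lemma contactMeasure_real_prefix (t : ℕ) (a : Fin t → V → V) :
    (contactMeasure G).real {ω | (fun i : Fin t => ω i) = a} = ∏ i, roundWeight G (a i) := by
  have hset : {ω : ℕ → V → V | (fun i : Fin t => ω i) = a} =
      Set.pi (Finset.range t : Set ℕ) fun i => if h : i < t then {a ⟨i, h⟩} else Set.univ := by
    ext ω
    simp only [Set.mem_ofPred_eq, Set.mem_pi, Finset.coe_range, Set.mem_Iio,
      funext_iff (f := fun i : Fin t => ω i)]
    constructor
    · intro h i hi
      simp [hi, h ⟨i, hi⟩]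
    · intro h i
      simpa using h i i.2
  rw [hset, Measure.real, contactMeasure, Measure.infinitePi_pi _ fun i _ => .of_discrete,
    Finset.prod_range, ENNReal.toReal_prod]
  refine Finset.prod_congr rfl fun i _ => ?_
  rw [dif_pos i.2, Measure.pi_singleton, ENNReal.toReal_prod, roundWeight]
  refine Finset.prod_congr rfl fun v _ => ?_
  rw [PMF.toMeasure_apply_singleton _ _ (measurableSet_singleton _)]
  rfl

lemma contactMeasure_real_eq_callsExp (t : ℕ) (p : List (V → V) → Prop) [DecidablePred p] :
    (contactMeasure G).real {ω | p (List.ofFn fun i : Fin t => ω i)} =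
      callsExp G t (fun l => if p l then 1 else 0) := by
  have hmeas : Measurable fun (ω : ℕ → V → V) (i : Fin t) => ω i := by fun_prop
  have hset : {ω : ℕ → V → V | p (List.ofFn fun i : Fin t => ω i)} =
      (fun (ω : ℕ → V → V) (i : Fin t) => ω i) ⁻¹'
        (Finset.univ.filter fun a : Fin t → V → V => p (List.ofFn a) : Finset _) := by
    ext ω
    simp
  rw [hset, ← sum_measureReal_preimage_singleton _ fun a _ => hmeas (measurableSet_singleton a),
    callsExp_eq_sum, Finset.sum_filter]
  refine Finset.sum_congr rfl fun a _ => ?_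
  rw [mul_ite, mul_one, mul_zero, ← contactMeasure_real_prefix G t a]
  rfl

end Measure

lemma informed_eq_spread (s : V) (ω : ℕ → V → V) (t : ℕ) :
    informed s ω t = spread {s} (List.ofFn fun i : Fin t => ω i) := by
  induction t with
  | zero => simp [informed, spread]
  | succ t ih =>
    rw [informed, ih, List.ofFn_succ', List.concat_eq_append, spread_append]
    rfl

/-! ### Consequences of the expansion -/

lemma mul_card_le_card_boundary {α : ℝ} (hα : ENNReal.ofReal α ≤ vertexExpansion G) {S : Finset V}
    (hS : S.Nonempty) (hS2 : 2 * S.card ≤ Fintype.card V) :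
    α * S.card ≤ (boundary G S).card := by
  have h := hα.trans (iInf_le _ ⟨S, hS, hS2⟩)
  have h0 : (S.card : ℝ≥0∞) ≠ 0 := by exact_mod_cast hS.card_pos.ne'
  rw [ENNReal.ofReal_le_iff_le_toReal (ENNReal.div_ne_top (ENNReal.natCast_ne_top _) h0),
    ENNReal.toReal_div, ENNReal.toReal_natCast, ENNReal.toReal_natCast] at h
  rwa [le_div_iff₀ (by exact_mod_cast hS.card_pos)] at h

lemma expansion_le_two {α : ℝ} (hn : 2 ≤ Fintype.card V)
    (hα : ENNReal.ofReal α ≤ vertexExpansion G) : α ≤ 2 := by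
  obtain ⟨S, -, hS⟩ := Finset.exists_subset_card_eq (s := (Finset.univ : Finset V))
    (n := (Fintype.card V) / 2) (by rw [Finset.card_univ]; omega)
  have hne : S.Nonempty := Finset.card_pos.1 (by omega)
  have h := mul_card_le_card_boundary G hα hne (by omega)
  have h1 := card_closedNbhd G S
  have h2 := Finset.card_le_univ (closedNbhd G S)
  have h3 : ((boundary G S).card : ℝ) ≤ 2 * S.card := by
    have : (boundary G S).card ≤ 2 * S.card := by omega
    exact_mod_cast this
  exact le_of_mul_le_mul_right (h.trans h3) (by exact_mod_cast hne.card_pos)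

lemma two_le_of_degree_le {α : ℝ} (hn : 4 ≤ Fintype.card V) (hα0 : 0 < α)
    (hα : ENNReal.ofReal α ≤ vertexExpansion G) {Δ : ℕ} (hΔ : ∀ v, G.degree v ≤ Δ) : 2 ≤ Δ := by
  have hbd : ∀ S : Finset V, S.Nonempty → 2 * S.card ≤ Fintype.card V →
      (boundary G S).Nonempty := by
    intro S hS hS2
    have h := mul_card_le_card_boundary G hα hS hS2
    have h1 : (0 : ℝ) < S.card := by exact_mod_cast hS.card_pos
    have h2 : (0 : ℝ) < (boundary G S).card := (by positivity : 0 < α * S.card).trans_le h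
    exact Finset.card_pos.1 (by exact_mod_cast h2)
  obtain ⟨v⟩ : Nonempty V := Fintype.card_pos_iff.1 (by omega)
  obtain ⟨u, hu⟩ := hbd {v} (Finset.singleton_nonempty v) (by rw [Finset.card_singleton]; omega)
  obtain ⟨huv, a, ha, hau⟩ := (mem_boundary G).1 hu
  rw [Finset.mem_singleton] at huv ha
  subst ha
  obtain ⟨w, hw⟩ := hbd {a, u} ⟨a, by simp⟩ (by rw [Finset.card_pair (Ne.symm huv)]; omega)
  obtain ⟨hwn, b, hb, hbw⟩ := (mem_boundary G).1 hw
  simp only [Finset.mem_insert, Finset.mem_singleton, not_or] at hwn hb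
  rcases hb with rfl | rfl
  · refine le_trans ?_ (hΔ b)
    rw [← Finset.card_pair (Ne.symm hwn.2), ← SimpleGraph.card_neighborFinset_eq_degree]
    refine Finset.card_le_card fun x hx => ?_
    simp only [Finset.mem_insert, Finset.mem_singleton] at hx
    rcases hx with rfl | rfl <;> simpa
  · refine le_trans ?_ (hΔ b)
    rw [← Finset.card_pair (Ne.symm hwn.1), ← SimpleGraph.card_neighborFinset_eq_degree]
    refine Finset.card_le_card fun x hx => ?_
    simp only [Finset.mem_insert, Finset.mem_singleton] at hx
    rcases hx with rfl | rfl
    · simpa using hau.symm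
    · simpa

/-! ### The time bound -/

lemma mul_pow_ceil_le_one {Δ : ℕ} (hΔ : 0 < Δ) :
    (Δ : ℝ) * (511 / 512) ^ ⌈512 * Real.log Δ⌉₊ ≤ 1 := by
  have hΔ' : (0 : ℝ) < Δ := by exact_mod_cast hΔ
  have h1 : (511 / 512 : ℝ) ≤ Real.exp (-(1 / 512)) := by
    linarith [Real.add_one_le_exp (-(1 / 512 : ℝ))]
  have h2 : (511 / 512 : ℝ) ^ ⌈512 * Real.log Δ⌉₊ ≤ Real.exp (-Real.log Δ) := by
    refine (pow_le_pow_left₀ (by norm_num) h1 _).trans ?_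
    rw [← Real.exp_nat_mul]
    refine Real.exp_le_exp.2 ?_
    have := Nat.le_ceil (512 * Real.log Δ)
    linarith
  rw [Real.exp_neg, Real.exp_log hΔ'] at h2
  calc (Δ : ℝ) * (511 / 512) ^ ⌈512 * Real.log Δ⌉₊ ≤ Δ * (Δ : ℝ)⁻¹ :=
        mul_le_mul_of_nonneg_left h2 hΔ'.le
    _ = 1 := mul_inv_cancel₀ hΔ'.ne'

lemma card_mul_failure_le {n : ℕ} (hn : 2 ≤ n) {α β : ℝ} (hα0 : 0 < α) (hα2 : α ≤ 2) :
    (n : ℝ) * (2 * ((n : ℝ) ^ 2 * (1 - α / 2304) ^ ⌈(β + 4) * 2304 * Real.log n / α⌉₊)) ≤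
      (n : ℝ) ^ (-β) := by
  have hn2 : (2 : ℝ) ≤ n := by exact_mod_cast hn
  have hn0 : (0 : ℝ) < n := by linarith
  set k := ⌈(β + 4) * 2304 * Real.log n / α⌉₊ with hk
  have hkle := Nat.le_ceil ((β + 4) * 2304 * Real.log n / α)
  rw [← hk, div_le_iff₀ hα0] at hkle
  have h1 : 1 - α / 2304 ≤ Real.exp (-(α / 2304)) := Real.one_sub_le_exp_neg _
  have h2 : (1 - α / 2304) ^ k ≤ (n : ℝ) ^ (-β) * ((n : ℝ) ^ 4)⁻¹ := by
    refine (pow_le_pow_left₀ (by linarith) h1 k).trans ?_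
    have h3 : (n : ℝ) ^ (-β) * ((n : ℝ) ^ 4)⁻¹ = Real.exp (-((β + 4) * Real.log n)) := by
      have h4 : ((n : ℝ) ^ 4)⁻¹ = (n : ℝ) ^ (-4 : ℝ) := by
        rw [Real.rpow_neg hn0.le]
        norm_cast
      rw [h4, ← Real.rpow_add hn0, Real.rpow_def_of_pos hn0]
      congr 1
      ring
    rw [h3, ← Real.exp_nat_mul]
    refine Real.exp_le_exp.2 ?_
    linarith
  have hβ0 : (0 : ℝ) < (n : ℝ) ^ (-β) := Real.rpow_pos_of_pos hn0 _
  calc (n : ℝ) * (2 * ((n : ℝ) ^ 2 * (1 - α / 2304) ^ k))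
      ≤ n * (2 * ((n : ℝ) ^ 2 * ((n : ℝ) ^ (-β) * ((n : ℝ) ^ 4)⁻¹))) := by gcongr
    _ = 2 / n * (n : ℝ) ^ (-β) := by field_simp
    _ ≤ 1 * (n : ℝ) ^ (-β) := by
        refine mul_le_mul_of_nonneg_right ?_ hβ0.le
        rwa [div_le_one hn0]
    _ = (n : ℝ) ^ (-β) := one_mul _

lemma rounds_le {n Δ : ℕ} (hn : 2 ≤ n) (hΔ : 2 ≤ Δ) {α β : ℝ} (hα0 : 0 < α) (hα2 : α ≤ 2)
    (hβ : 0 < β) :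
    ((⌈(β + 4) * 2304 * Real.log n / α⌉₊ * (2 * ⌈512 * Real.log Δ⌉₊ + 1) +
      ⌈(β + 4) * 2304 * Real.log n / α⌉₊ * (2 * ⌈512 * Real.log Δ⌉₊ + 1) : ℕ) : ℝ) ≤
      2 * ((β + 4) * 2304 + 4) * 1030 * (Real.log n * Real.log Δ / α) := by
  have hhalf : ∀ {x : ℕ}, 2 ≤ x → (1 / 2 : ℝ) ≤ Real.log x := by
    intro x hx
    have h1 : Real.log 2 ≤ Real.log x :=
      Real.log_le_log (by norm_num) (by exact_mod_cast hx)
    linarith [Real.log_two_gt_d9]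
  have hL := hhalf hn
  have hD := hhalf hΔ
  set L := Real.log n
  set D := Real.log Δ
  have hk : (⌈(β + 4) * 2304 * L / α⌉₊ : ℝ) ≤ ((β + 4) * 2304 + 4) * (L / α) := by
    have h1 := (Nat.ceil_lt_add_one (a := (β + 4) * 2304 * L / α) (by positivity)).le
    have h2 : 1 ≤ 4 * (L / α) := by
      rw [← mul_div_assoc, le_div_iff₀ hα0]
      linarith
    have h3 : (β + 4) * 2304 * L / α = (β + 4) * 2304 * (L / α) := by ring
    linarith
  have hJ : 2 * (⌈512 * D⌉₊ : ℝ) + 1 ≤ 1030 * D := by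
    have h1 := (Nat.ceil_lt_add_one (a := 512 * D) (by positivity)).le
    linarith
  have hprod := mul_le_mul hk hJ (by positivity) (by positivity)
  push_cast
  have h4 : 2 * ((β + 4) * 2304 + 4) * 1030 * (L * D / α) =
      2 * (((β + 4) * 2304 + 4) * (L / α) * (1030 * D)) := by ring
  rw [h4]
  linarith

/-- The bound for graphs with at least four nodes, where `log Δ` is positive. -/
lemma contactMeasure_informed_ge [MeasurableSpace V] [DiscreteMeasurableSpace V] {α β : ℝ}
    (hβ : 0 < β) (hn : 4 ≤ Fintype.card V) {Δ : ℕ} (hΔ : G.maxDegree ≤ Δ) (hα0 : 0 < α)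
    (hα : ENNReal.ofReal α ≤ vertexExpansion G) (s : V) :
    1 - (Fintype.card V : ℝ) ^ (-β) ≤ (contactMeasure G).real
      {ω | ∃ t : ℕ, (t : ℝ) ≤ 2 * ((β + 4) * 2304 + 4) * 1030 *
        (Real.log (Fintype.card V) * Real.log Δ / α) ∧ informed s ω t = Finset.univ} := by
  have hdeg : ∀ v, G.degree v ≤ Δ := fun v => (G.degree_le_maxDegree v).trans hΔ
  have hΔ2 : 2 ≤ Δ := two_le_of_degree_le G hn hα0 hα hdeg
  have hα2 : α ≤ 2 := expansion_le_two G (by omega) hα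
  set J := ⌈512 * Real.log Δ⌉₊ with hJ
  set k := ⌈(β + 4) * 2304 * Real.log (Fintype.card V) / α⌉₊ with hk
  set T := k * (2 * J + 1) with hT
  have hhalf : ∀ v : V, callsExp G T
      (fun l => if 2 * (spread {v} l).card ≤ Fintype.card V then 1 else 0) ≤
      (Fintype.card V : ℝ) ^ 2 * (1 - α / 2304) ^ k := by
    refine callsExp_half_le G (by linarith) (fun S hS hS2 => ?_) k
    exact callsExp_spreadPotential_le G hS hα2 (mul_card_le_card_boundary G hα hS hS2) hdeg
      (mul_pow_ceil_le_one (by omega))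
  have hall := callsExp_spread_eq_univ_ge G hhalf s
  have hfail := card_mul_failure_le (n := Fintype.card V) (β := β) (by omega) hα0 hα2
  rw [← hk] at hfail
  rw [← contactMeasure_real_eq_callsExp G (T + T) fun l => spread {s} l = Finset.univ] at hall
  refine (sub_le_sub_left hfail 1).trans (hall.trans (measureReal_mono fun ω hω => ?_))
  refine ⟨T + T, ?_, ?_⟩
  · exact rounds_le (by omega) hΔ2 hα0 hα2 hβ
  · rw [informed_eq_spread]
    exact hω

end RumorSpreading

theorem theorem1 (β : ℝ) (hβ : 0 < β) :
    ∃ C K : ℝ, 0 < C ∧ 0 < K ∧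
      ∀ (V : Type*) [Fintype V] [DecidableEq V] [MeasurableSpace V] [DiscreteMeasurableSpace V]
        (G : SimpleGraph V) [DecidableRel G.Adj] (Δ : ℕ) (α : ℝ) (s : V),
        G.maxDegree ≤ Δ → 0 < α → ENNReal.ofReal α ≤ RumorSpreading.vertexExpansion G →
          1 - K * (Fintype.card V : ℝ) ^ (-β) ≤
            (RumorSpreading.contactMeasure G).real
              {ω | ∃ t : ℕ, (t : ℝ) ≤ C * (Real.log (Fintype.card V) * Real.log Δ / α) ∧
                RumorSpreading.informed s ω t = Finset.univ} := by
  refine ⟨2 * ((β + 4) * 2304 + 4) * 1030, 4 ^ β, by positivity, by positivity, ?_⟩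
  intro V _ _ _ _ G _ Δ α s hΔ hα0 hα
  have hn0 : (0 : ℝ) < Fintype.card V := by exact_mod_cast Fintype.card_pos_iff.2 ⟨s⟩
  have hpow0 : 0 < (Fintype.card V : ℝ) ^ (-β) := Real.rpow_pos_of_pos hn0 _
  rcases lt_or_ge (Fintype.card V) 4 with hn | hn
  · -- Two nodes with `Δ = 1` would leave no round at all, as `log Δ = 0`; the constant `4 ^ β`
    -- makes the claim trivial for fewer than four nodes.
    have h4 : (Fintype.card V : ℝ) ≤ 4 := by exact_mod_cast hn.le
    have h1 : (Fintype.card V : ℝ) ^ β ≤ 4 ^ β := Real.rpow_le_rpow hn0.le h4 hβ.le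
    have h2 : 1 ≤ (4 : ℝ) ^ β * (Fintype.card V : ℝ) ^ (-β) := by
      rw [Real.rpow_neg hn0.le, ← div_eq_mul_inv, one_le_div (Real.rpow_pos_of_pos hn0 _)]
      exact h1
    exact (sub_nonpos.2 h2).trans measureReal_nonneg
  · refine le_trans (sub_le_sub_left ?_ 1)
      (RumorSpreading.contactMeasure_informed_ge G hβ hn hΔ hα0 hα s)
    exact le_mul_of_one_le_left hpow0.le (Real.one_le_rpow (by norm_num) hβ.le)
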